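/- In online class-constrained bin packing with parameter $t\ge 1$, items arrive one by one; each item has a rational size in $(0,1]$ and a color, and on arrival it must be assigned irrevocably to a bin, without information on later items. Every bin may contain items of total size at most $1$ and of at most $t$ different colors (with any number of items of each color, and with an unlimited supply of colors). The cost $A(I)$ of a deterministic online algorithm $A$ on an input sequence $I$ is the number of bins that it uses, and $OPT(I)$ is the minimum number of bins in any packing of the items of $I$. The (asymptotic) competitive ratio of $A$ is $$R_A=\limsup_{Q\to\infty}\ \frac1Q\,\sup\{A(I): OPT(I)=Q\}\in[0,\infty].$$ Theorem. Every deterministic online algorithm $A$ for class-constrained bin packing satisfies $R_A\ge 1.717668486$ if $t=2$, and $R_A\ge 1.80814287$ if $t=3$. -/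

import Mathlib

open scoped ENNReal

/-- An item of class-constrained bin packing: a rational size in `(0,1]` and a color.
Colors are named by natural numbers, so there is an unlimited supply of them. -/
structure Item where
  size : ℚ
  color : ℕ
  size_pos : 0 < size
  size_le_one : size ≤ 1

/-- `p` assigns a bin (a natural number) to each position of the input sequence `I`. It is a
packing if every bin receives items of total size at most `1` and of at most `t` distinct
colors. -/
def IsPacking (t : ℕ) (I : List Item) (p : Fin I.length → ℕ) : Prop :=
  ∀ b : ℕ,
    ∑ i with p i = b, (I.get i).size ≤ 1 ∧
    ((Finset.univ.filter fun i => p i = b).image fun i => (I.get i).color).card ≤ t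

/-- The number of nonempty bins of an assignment. -/
def numBins (I : List Item) (p : Fin I.length → ℕ) : ℕ :=
  (Finset.univ.image p).card

/-- The cost of an optimal offline solution. -/
noncomputable def opt (t : ℕ) (I : List Item) : ℕ :=
  sInf {n : ℕ | ∃ p : Fin I.length → ℕ, IsPacking t I p ∧ numBins I p = n}

/-- For `t ≥ 1` the infimum that defines `opt` is taken over a nonempty set
(and hence is a minimum): every item can be put in a bin of its own. -/
theorem exists_isPacking {t : ℕ} (ht : 1 ≤ t) (I : List Item) :
    IsPacking t I (fun i : Fin I.length => (i : ℕ)) := by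
  intro b
  have hcard : (Finset.univ.filter fun i : Fin I.length => (i : ℕ) = b).card ≤ 1 := by
    rw [Finset.card_le_one]
    intro i hi j hj
    simp only [Finset.mem_filter, Finset.mem_univ, true_and] at hi hj
    exact Fin.ext (hi.trans hj.symm)
  refine ⟨?_, Finset.card_image_le.trans (hcard.trans ht)⟩
  calc ∑ i ∈ Finset.univ.filter fun i : Fin I.length => (i : ℕ) = b, (I.get i).size
      ≤ (Finset.univ.filter fun i : Fin I.length => (i : ℕ) = b).card • (1 : ℚ) :=
        Finset.sum_le_card_nsmul _ _ _ fun i _ => (I.get i).size_le_one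
    _ ≤ 1 := by
        rw [nsmul_eq_mul, mul_one]
        exact_mod_cast hcard

/-- A deterministic online algorithm for class-constrained bin packing with parameter `t`:
the bin of the current item is determined by the earlier items (in their order of arrival) and
by the current item, without information on later items, and the resulting assignment is a
packing for every input sequence. -/
structure OnlineAlgorithm (t : ℕ) where
  assign : List Item → Item → ℕ
  valid : ∀ I : List Item, IsPacking t I fun i => assign (I.take i) (I.get i)

namespace OnlineAlgorithm

/-- The number of bins that the algorithm uses for the input sequence `I`. -/
def cost {t : ℕ} (A : OnlineAlgorithm t) (I : List Item) : ℕ :=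
  numBins I fun i => A.assign (I.take i) (I.get i)

/-- The largest cost of the algorithm over all inputs whose optimal cost is `Q`
(infinite if these costs are unbounded). -/
noncomputable def worstCost {t : ℕ} (A : OnlineAlgorithm t) (Q : ℕ) : ℝ≥0∞ :=
  ⨆ (I : List Item) (_ : opt t I = Q), (A.cost I : ℝ≥0∞)

/-- The (asymptotic) competitive ratio of the algorithm. -/
noncomputable def competitiveRatio {t : ℕ} (A : OnlineAlgorithm t) : ℝ≥0∞ :=
  Filter.limsup (fun Q : ℕ => A.worstCost Q / (Q : ℝ≥0∞)) Filter.atTop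

end OnlineAlgorithm

/-! Suppose that `A` uses at most `R * OPT` bins whenever `OPT` is large. The adversary starts with
`N` tiny items of distinct colors, for which only the bound `t` on colors matters. A bin with `t` of
them is full: it admits no new color. If few bins are opened, many of them are full.

Opening many bins is punished by huge items. Sizes are chosen adaptively (`exists_labels_cut`) so
that every tiny item that opens a bin is more than `t` times as large as every one that does not.
Huge items then fit offline on top of `t` non-openers, but never together with an opener
(`ineq_of_tiny_phase`).

Opening few bins is punished by items of one further color, for which full bins are useless: `n` low
items slightly above `1 / 7`, then `n` high items slightly above `1 / 3`, then items of one of two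
alternative sizes. The first, about `11 / 21`, completes a low and a high item to a bin. The second,
almost `2 / 3`, completes a high item; adaptive tuning makes it fit exactly with the high items that
opened no bin of the extra color. Except before the items of the first size, the adversary may
finish with huge items in the colors of tiny items outside full bins. They need bins other than the
full bins and those of the extra color, whereas offline they sit on tiny items in bins without the
extra color (`ineq_of_extra`).

Every stopping point gives an inequality that is linear in the bin counts, up to minima and
rounding. A weight argument over the bins of the extra color (`weight_ineq`) bounds how many of them
stay open to third-phase items. For the two stated values of `R` the resulting system is infeasible.
-/

/-! ### Input sequences and packings indexed by natural numbers -/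

/-- The input sequence consisting of the first `m` terms of `f`. -/
def seqList (f : ℕ → Item) (m : ℕ) : List Item := (List.range m).map f

/-- The item of the given size and color (of size `1` if the size is not admissible). -/
def mkItem (s : ℚ) (c : ℕ) : Item :=
  if h : 0 < s ∧ s ≤ 1 then ⟨s, c, h.1, h.2⟩ else ⟨1, c, one_pos, le_rfl⟩

@[simp] theorem mkItem_color (s : ℚ) (c : ℕ) : (mkItem s c).color = c := by
  unfold mkItem; split <;> rfl

theorem mkItem_size {s : ℚ} {c : ℕ} (h0 : 0 < s) (h1 : s ≤ 1) : (mkItem s c).size = s := by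
  simp [mkItem, h0, h1]

theorem length_seqList (f : ℕ → Item) (m : ℕ) : (seqList f m).length = m := by
  simp [seqList]

theorem get_seqList (f : ℕ → Item) (m : ℕ) (i : Fin (seqList f m).length) :
    (seqList f m).get i = f i := by
  rw [List.get_eq_getElem]
  simp [seqList]

theorem take_seqList (f : ℕ → Item) {m i : ℕ} (h : i ≤ m) :
    (seqList f m).take i = seqList f i := by
  simp [seqList, ← List.map_take, List.take_range, h]

theorem isPacking_iff {t : ℕ} {I : List Item} {f : ℕ → Item}
    (hf : ∀ i : Fin I.length, I.get i = f i) (p : ℕ → ℕ) :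
    IsPacking t I (fun i => p i) ↔
      ∀ b, ∑ i ∈ Finset.range I.length with p i = b, (f i).size ≤ 1 ∧
        (((Finset.range I.length).filter fun i => p i = b).image fun i => (f i).color).card
          ≤ t := by
  unfold IsPacking
  refine forall_congr' fun b => ?_
  have h1 : ∑ i ∈ Finset.univ.filter fun i : Fin I.length => p i = b, (I.get i).size
      = ∑ i ∈ Finset.range I.length with p i = b, (f i).size := by
    simp only [hf, Finset.sum_filter]
    exact Fin.sum_univ_eq_sum_range (fun i => if p i = b then (f i).size else 0) I.length
  have h2 : ∀ S : Finset (Fin I.length), (∀ i, i ∈ S ↔ p i = b) →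
      S.image (fun i => (I.get i).color)
        = (((Finset.range I.length).filter fun i => p i = b).image fun i => (f i).color) := by
    intro S hS
    ext c
    simp only [hf, Finset.mem_image, Finset.mem_filter, Finset.mem_range, hS]
    constructor
    · rintro ⟨i, hi, rfl⟩
      exact ⟨i, ⟨i.2, hi⟩, rfl⟩
    · rintro ⟨i, ⟨hi, hb⟩, rfl⟩
      exact ⟨⟨i, hi⟩, hb, rfl⟩
  rw [h1, h2 _ fun i => by simp]

theorem numBins_eq (I : List Item) (p : ℕ → ℕ) :
    numBins I (fun i => p i) = ((Finset.range I.length).image p).card := by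
  unfold numBins
  congr 1
  ext b
  simp only [Finset.mem_image, Finset.mem_univ, true_and, Finset.mem_range]
  constructor
  · rintro ⟨i, rfl⟩
    exact ⟨i, i.2, rfl⟩
  · rintro ⟨i, hi, rfl⟩
    exact ⟨⟨i, hi⟩, rfl⟩

theorem opt_seqList_le {t m : ℕ} {f : ℕ → Item} (p : ℕ → ℕ)
    (hs : ∀ b, ∑ i ∈ Finset.range m with p i = b, (f i).size ≤ 1)
    (hc : ∀ b, (((Finset.range m).filter fun i => p i = b).image fun i => (f i).color).card
      ≤ t) :
    opt t (seqList f m) ≤ ((Finset.range m).image p).card := by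
  refine Nat.sInf_le ⟨fun i => p i, ?_, ?_⟩
  · rw [isPacking_iff (get_seqList f m)]
    intro b
    rw [length_seqList]
    exact ⟨hs b, hc b⟩
  · rw [numBins_eq, length_seqList]

/-- A bin covers at most `t` of the `N` colors. With `t * Q₀ ≤ N` this puts the optimum above the
threshold from which competitiveness is available. -/
theorem le_mul_opt {t m N : ℕ} (ht : 1 ≤ t) {f : ℕ → Item} (hN : N ≤ m)
    (hf : ∀ i < N, (f i).color = i) : N ≤ t * opt t (seqList f m) := by
  have hne : {n : ℕ | ∃ p : Fin (seqList f m).length → ℕ,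
      IsPacking t (seqList f m) p ∧ numBins (seqList f m) p = n}.Nonempty :=
    ⟨_, _, exists_isPacking ht _, rfl⟩
  obtain ⟨p, hp, hpn⟩ := Nat.sInf_mem hne
  change numBins (seqList f m) p = opt t (seqList f m) at hpn
  rw [← hpn]
  clear hpn hne
  revert p
  generalize hI : seqList f m = I
  intro p hp
  have hlen : I.length = m := hI ▸ length_seqList f m
  have hcol : ∀ i : Fin I.length, (i : ℕ) < N → (I.get i).color = i := fun i hi => by
    subst hI
    rw [get_seqList, hf _ hi]
  have h1 : Finset.range N ⊆ (Finset.univ.image p).biUnion fun b =>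
      (Finset.univ.filter fun i => p i = b).image fun i => (I.get i).color := by
    intro i hi
    rw [Finset.mem_range] at hi
    have hi' : i < I.length := by omega
    refine Finset.mem_biUnion.2 ⟨p ⟨i, hi'⟩, Finset.mem_image_of_mem _ (Finset.mem_univ _), ?_⟩
    refine Finset.mem_image.2 ⟨⟨i, hi'⟩, by simp, ?_⟩
    exact hcol ⟨i, hi'⟩ hi
  calc N = (Finset.range N).card := (Finset.card_range N).symm
    _ ≤ _ := Finset.card_le_card h1
    _ ≤ (Finset.univ.image p).card * t :=
        Finset.card_biUnion_le_card_mul _ _ _ fun b _ => (hp b).2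
    _ = t * numBins I p := by rw [mul_comm]; rfl

/-! ### Bins of an online algorithm along a sequence -/

namespace OnlineAlgorithm

variable {t : ℕ} (A : OnlineAlgorithm t)

/-- The bin into which the algorithm puts the `i`-th item of the sequence `f`. -/
def binOf (f : ℕ → Item) (i : ℕ) : ℕ := A.assign (seqList f i) (f i)

/-- Causality: it lets the adversary adapt, and lets different continuations share the bins of their
common prefix. -/
theorem binOf_congr {f g : ℕ → Item} {i : ℕ} (h : ∀ j ≤ i, f j = g j) :
    A.binOf f i = A.binOf g i := by
  have : seqList f i = seqList g i :=
    List.map_congr_left fun j hj => h j (List.mem_range.1 hj).le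
  rw [binOf, binOf, this, h i le_rfl]

theorem assign_seqList (f : ℕ → Item) (m : ℕ) :
    (fun i : Fin (seqList f m).length =>
      A.assign ((seqList f m).take i) ((seqList f m).get i)) =
      fun i : Fin (seqList f m).length => A.binOf f i := by
  funext i
  have hi : (i : ℕ) ≤ m := (i.2.trans_eq (length_seqList f m)).le
  rw [get_seqList, take_seqList f hi, binOf]

theorem cost_seqList (f : ℕ → Item) (m : ℕ) :
    A.cost (seqList f m) = ((Finset.range m).image (A.binOf f)).card := by
  rw [cost, assign_seqList, numBins_eq, length_seqList]

theorem sum_binOf_le (f : ℕ → Item) (m b : ℕ) :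
    ∑ i ∈ Finset.range m with A.binOf f i = b, (f i).size ≤ 1 := by
  have h := A.valid (seqList f m)
  rw [assign_seqList, isPacking_iff (get_seqList f m)] at h
  simpa only [length_seqList] using (h b).1

theorem card_color_binOf_le (f : ℕ → Item) (m b : ℕ) :
    (((Finset.range m).filter fun i => A.binOf f i = b).image fun i => (f i).color).card
      ≤ t := by
  have h := A.valid (seqList f m)
  rw [assign_seqList, isPacking_iff (get_seqList f m)] at h
  simpa only [length_seqList] using (h b).2

/-- Distinct items in one bin have total size at most `1`. -/
theorem sum_le_one_of_binOf (f : ℕ → Item) (b : ℕ) (s : Finset ℕ)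
    (hs : ∀ i ∈ s, A.binOf f i = b) : ∑ i ∈ s, (f i).size ≤ 1 := by
  refine le_trans (Finset.sum_le_sum_of_subset_of_nonneg ?_ fun i _ _ => (f i).size_pos.le)
    (A.sum_binOf_le f (s.sup id + 1) b)
  intro i hi
  exact Finset.mem_filter.2 ⟨Finset.mem_range.2 (Nat.lt_succ_of_le (Finset.le_sup (f := id) hi)),
    hs i hi⟩

theorem card_color_le_of_binOf (f : ℕ → Item) (b : ℕ) (s : Finset ℕ)
    (hs : ∀ i ∈ s, A.binOf f i = b) : (s.image fun i => (f i).color).card ≤ t := by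
  refine le_trans (Finset.card_le_card (Finset.image_subset_image ?_))
    (A.card_color_binOf_le f (s.sup id + 1) b)
  intro i hi
  exact Finset.mem_filter.2 ⟨Finset.mem_range.2 (Nat.lt_succ_of_le (Finset.le_sup (f := id) hi)),
    hs i hi⟩

/-- If the competitive ratio is less than `R`, then the algorithm is `R`-competitive on all
inputs of large optimal cost. -/
theorem exists_cost_le {R : ℝ} (hR0 : 0 ≤ R) (h : A.competitiveRatio < ENNReal.ofReal R) :
    ∃ Q₀ : ℕ, ∀ I : List Item, Q₀ ≤ opt t I → (A.cost I : ℝ) ≤ R * opt t I := by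
  have h1 := Filter.eventually_lt_of_limsup_lt h
  obtain ⟨Q₀, hQ⟩ := Filter.eventually_atTop.1 h1
  refine ⟨max Q₀ 1, fun I hI => ?_⟩
  have h2 := hQ (opt t I) ((le_max_left _ _).trans hI)
  have hpos : 0 < opt t I := (le_max_right Q₀ 1).trans hI
  have h3 : (A.cost I : ℝ≥0∞) ≤ A.worstCost (opt t I) := by
    unfold worstCost
    exact le_iSup₂ (f := fun (J : List Item) (_ : opt t J = opt t I) => (A.cost J : ℝ≥0∞)) I rfl
  have h4 : (A.cost I : ℝ≥0∞) / (opt t I : ℝ≥0∞) ≤ ENNReal.ofReal R :=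
    (ENNReal.div_le_div_right h3 _).trans h2.le
  have h5 : (A.cost I : ℝ≥0∞) ≤ ENNReal.ofReal R * (opt t I : ℝ≥0∞) := by
    rwa [ENNReal.div_le_iff (by exact_mod_cast hpos.ne') (ENNReal.natCast_ne_top _)] at h4
  have h6 : ENNReal.ofReal (A.cost I : ℝ) ≤ ENNReal.ofReal (R * opt t I) := by
    rw [ENNReal.ofReal_mul hR0, ENNReal.ofReal_natCast, ENNReal.ofReal_natCast]
    exact h5
  exact (ENNReal.ofReal_le_ofReal_iff (by positivity)).1 h6

end OnlineAlgorithm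

/-! ### Adaptive labelling -/

/-- Adaptive labelling: if step `i` is classified by a predicate depending only on the labels up
to step `i`, the labels can be chosen such that the steps of the class all get larger labels than
the other steps. -/
theorem exists_separating_labels (n : ℕ) : ∀ (lo : ℕ) (P : (ℕ → ℕ) → ℕ → Prop),
    (∀ e e' i, (∀ j ≤ i, e j = e' j) → (P e i ↔ P e' i)) →
    ∃ e : ℕ → ℕ, (∀ i < n, lo ≤ e i ∧ e i < lo + 4 ^ n) ∧
      ∀ i < n, ∀ j < n, P e i → ¬ P e j → e j < e i := by
  induction n with
  | zero => exact fun lo P _ => ⟨fun _ => 0, by simp, by simp⟩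
  | succ n ih =>
    intro lo P hP
    let cons : ℕ → (ℕ → ℕ) → ℕ → ℕ := fun m e i => Nat.casesOn i m e
    have hcausal : ∀ m e e' i, (∀ j ≤ i, e j = e' j) →
        (P (cons m e) (i + 1) ↔ P (cons m e') (i + 1)) := by
      intro m e e' i h
      refine hP _ _ _ fun j hj => ?_
      cases j with
      | zero => rfl
      | succ j => exact h j (by omega)
    have hzero : ∀ m e e', (P (cons m e) 0 ↔ P (cons m e') 0) := by
      intro m e e'
      refine hP _ _ _ fun j hj => ?_
      obtain rfl : j = 0 := by omega
      rfl
    have h4 : 4 ^ (n + 1) = 4 * 4 ^ n := by rw [pow_succ, mul_comm]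
    have h1 : 1 ≤ 4 ^ n := Nat.one_le_pow _ _ (by norm_num)
    -- The pivot `m` is the label of the first step. The class of that step depends on `m` alone, so
    -- it is known before the later labels are confined to one side: below `m` if the step is in the
    -- class, above `m` otherwise.
    set m := lo + 4 ^ n with hm
    by_cases h0 : P (cons m 0) 0
    · obtain ⟨e, he, hsep⟩ := ih lo (fun e i => P (cons m e) (i + 1)) (hcausal m)
      refine ⟨cons m e, ?_, ?_⟩
      · rintro (_ | i) hi
        · change lo ≤ m ∧ m < _
          omega
        · have := he i (by omega)
          change lo ≤ e i ∧ e i < _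
          omega
      · rintro (_ | i) hi (_ | j) hj hPi hPj
        · exact absurd hPi hPj
        · exact (he j (by omega)).2
        · exact absurd ((hzero m 0 e).1 h0) hPj
        · exact hsep i (by omega) j (by omega) hPi hPj
    · obtain ⟨e, he, hsep⟩ := ih (m + 1) (fun e i => P (cons m e) (i + 1)) (hcausal m)
      refine ⟨cons m e, ?_, ?_⟩
      · rintro (_ | i) hi
        · change lo ≤ m ∧ m < _
          omega
        · have := he i (by omega)
          change lo ≤ e i ∧ e i < _
          omega
      · rintro (_ | i) hi (_ | j) hj hPi hPj
        · exact absurd hPi hPj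
        · exact absurd ((hzero m e 0).1 hPi) h0
        · exact Nat.lt_of_succ_le (he i (by omega)).1
        · exact hsep i (by omega) j (by omega) hPi hPj

/-! ### Ranks and explicit offline packings -/

/-- The elements of a set `D` of natural numbers below `N` can be enumerated before the other
numbers below `N`; `r` is the rank and `s` its inverse. -/
theorem exists_rank {N : ℕ} (D : Finset ℕ) (hD : ∀ i ∈ D, i < N) :
    ∃ r s : ℕ → ℕ, (∀ i < N, r i < N ∧ s (r i) = i) ∧ (∀ i < N, s i < N ∧ r (s i) = i) ∧
      ∀ i < N, (i ∈ D ↔ r i < D.card) := by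
  have hcard : Fintype.card {x : Fin N // (x : ℕ) ∈ D}
      = Fintype.card {x : Fin N // (x : ℕ) < D.card} := by
    have hDN : D.card ≤ N := by
      simpa using Finset.card_le_card (fun i hi => Finset.mem_range.2 (hD i hi) :
        D ⊆ Finset.range N)
    rw [Fintype.card_subtype, Fintype.card_subtype]
    have h1 : (Finset.univ.filter fun x : Fin N => (x : ℕ) ∈ D).card = D.card := by
      refine Finset.card_bij (fun x _ => (x : ℕ)) (by simp) (fun x _ y _ h => Fin.ext h) ?_
      intro b hb
      exact ⟨⟨b, hD b hb⟩, by simpa using hb, rfl⟩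
    have h2 : (Finset.univ.filter fun x : Fin N => (x : ℕ) < D.card).card = D.card := by
      conv_rhs => rw [← Finset.card_range D.card]
      refine Finset.card_bij (fun x _ => (x : ℕ)) (by simp) (fun x _ y _ h => Fin.ext h) ?_
      intro b hb
      have hb' := Finset.mem_range.1 hb
      exact ⟨⟨b, by omega⟩, by simpa using hb', rfl⟩
    rw [h1, h2]
  let e := Fintype.equivOfCardEq hcard
  let σ : Equiv.Perm (Fin N) := e.extendSubtype
  refine ⟨fun i => if h : i < N then σ ⟨i, h⟩ else i,
    fun i => if h : i < N then σ.symm ⟨i, h⟩ else i, ?_, ?_, ?_⟩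
  · intro i hi
    simp [hi]
  · intro i hi
    simp [hi]
  · intro i hi
    simp only [hi, dif_pos]
    constructor
    · exact fun h => e.extendSubtype_mem ⟨i, hi⟩ h
    · intro h
      by_contra hn
      exact e.extendSubtype_not_mem ⟨i, hi⟩ hn h

/-- An element of residue `b` is determined by its quotient, which lies in `[c, t)`. With `c = 1`
this covers bins that a round-robin distribution skips in its first round. -/
theorem card_filter_mod_le {A : Finset ℕ} {t W b : ℕ} {q : ℕ → ℕ}
    (hq : ∀ i ∈ A, q i < t * W) (hinj : ∀ i ∈ A, ∀ j ∈ A, q i = q j → i = j) (c : ℕ)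
    (hc : ∀ i ∈ A, q i % W = b → c ≤ q i / W) :
    (A.filter fun i => q i % W = b).card ≤ t - c := by
  rw [← Nat.card_Ico c t]
  refine Finset.card_le_card_of_injOn (fun i => q i / W) ?_ ?_
  · intro i hi
    have hi := Finset.mem_filter.1 hi
    refine Finset.mem_coe.2 (Finset.mem_Ico.2 ⟨hc i hi.1 hi.2, ?_⟩)
    have := hq i hi.1
    exact Nat.div_lt_of_lt_mul (by rwa [mul_comm])
  · intro i hi j hj h
    have hi := Finset.mem_filter.1 hi
    have hj := Finset.mem_filter.1 hj
    refine hinj i hi.1 j hj.1 ?_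
    rw [← Nat.div_add_mod (q i) W, ← Nat.div_add_mod (q j) W, hi.2, hj.2]
    simp only at h
    rw [h]

theorem card_filter_div_le {A : Finset ℕ} {t b : ℕ} (ht : 0 < t) {q : ℕ → ℕ}
    (hinj : ∀ i ∈ A, ∀ j ∈ A, q i = q j → i = j) :
    (A.filter fun i => q i / t = b).card ≤ t := by
  conv_rhs => rw [← Finset.card_range t]
  refine Finset.card_le_card_of_injOn (fun i => q i % t) ?_ ?_
  · intro i _
    exact Finset.mem_coe.2 (Finset.mem_range.2 (Nat.mod_lt _ ht))
  · intro i hi j hj h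
    have hi := Finset.mem_filter.1 hi
    have hj := Finset.mem_filter.1 hj
    refine hinj i hi.1 j hj.1 ?_
    rw [← Nat.div_add_mod (q i) t, ← Nat.div_add_mod (q j) t, hi.2, hj.2]
    simp only at h
    rw [h]

/-- Offline packing of `N` small items of distinct colors, `m` items of one further color that
fit into `v` bins, and `K` huge items whose colors are colors of small items. -/
theorem opt_le_of_huge {t N m K v W : ℕ} {f : ℕ → Item} {η : ℚ} {r s π : ℕ → ℕ}
    (hη : η ≤ 1) (hW : 0 < W) (hK : K ≤ N)
    (hr : ∀ i < N, r i < N ∧ s (r i) = i) (hs : ∀ i < N, s i < N ∧ r (s i) = i)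
    (hsize : ∑ i ∈ Finset.range N, (f i).size ≤ η) (hcol : ∀ i < N, (f i).color = i)
    (hredc : ∀ j < m, (f (N + j)).color = N) (hπ : ∀ j < m, π j < v)
    (hreds : ∀ b < v, ∑ j ∈ Finset.range m with π j = b, (f (N + j)).size ≤ 1 - η)
    (hbigs : ∀ k < K, (f (N + m + k)).size ≤ 1 - η)
    (hbigc : ∀ k < K, (f (N + m + k)).color = s k)
    (h1 : v + K ≤ W) (h2 : N + v ≤ t * W) : opt t (seqList f (N + m + K)) ≤ W := by
  classical
  -- The tiny items go round robin by rank, starting at bin `v`. So bin `v + k` holds the tiny item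
  -- of rank `k`, whose color huge item `k` repeats, and the bins below `v` miss the first round,
  -- which leaves one slot for the extra color.
  let p : ℕ → ℕ := fun i =>
    if i < N then (v + r i) % W else if i < N + m then π (i - N) else v + (i - N - m)
  have p1 : ∀ i < N, p i = (v + r i) % W := fun i hi => by simp [p, hi]
  have p2 : ∀ j < m, p (N + j) = π j := fun j hj => by simp [p, hj]
  have p3 : ∀ k, p (N + m + k) = v + k := fun k => by
    have e1 : ¬ N + m + k < N := by omega
    have e2 : ¬ N + m + k < N + m := by omega
    simp only [p, e1, e2, if_false]
    omega
  have hinj : ∀ i ∈ Finset.range N, ∀ j ∈ Finset.range N, v + r i = v + r j → i = j := by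
    intro i hi j hj h
    rw [← (hr i (Finset.mem_range.1 hi)).2, ← (hr j (Finset.mem_range.1 hj)).2,
      Nat.add_left_cancel h]
  have hlt : ∀ i ∈ Finset.range N, v + r i < t * W := by
    intro i hi
    have := (hr i (Finset.mem_range.1 hi)).1
    omega
  refine (opt_seqList_le p ?_ ?_).trans ?_
  · intro b
    rw [Finset.sum_filter, Finset.sum_range_add, Finset.sum_range_add]
    have e1 : ∑ i ∈ Finset.range N, (if p i = b then (f i).size else 0) ≤ η := by
      refine le_trans (Finset.sum_le_sum fun i _ => ?_) hsize
      split_ifs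
      · exact le_rfl
      · exact (f i).size_pos.le
    have e2 : ∑ j ∈ Finset.range m, (if p (N + j) = b then (f (N + j)).size else 0)
        = ∑ j ∈ Finset.range m with π j = b, (f (N + j)).size := by
      rw [Finset.sum_filter]
      refine Finset.sum_congr rfl fun j hj => ?_
      rw [p2 j (Finset.mem_range.1 hj)]
    by_cases hb : b < v
    · have e3 : ∑ k ∈ Finset.range K, (if p (N + m + k) = b then (f (N + m + k)).size else 0)
          = 0 := by
        refine Finset.sum_eq_zero fun k _ => ?_
        rw [p3, if_neg (by omega)]
      have := hreds b hb
      rw [e2, e3]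
      linarith
    · have e4 : ∑ j ∈ Finset.range m with π j = b, (f (N + j)).size = 0 := by
        refine Finset.sum_eq_zero fun j hj => ?_
        rw [Finset.mem_filter, Finset.mem_range] at hj
        have := hπ j hj.1
        omega
      have e3 : ∑ k ∈ Finset.range K, (if p (N + m + k) = b then (f (N + m + k)).size else 0)
          ≤ 1 - η := by
        by_cases hbK : b - v < K
        · rw [Finset.sum_eq_single (b - v)]
          · rw [if_pos (by rw [p3]; omega)]
            exact hbigs _ hbK
          · intro k _ hk
            rw [p3, if_neg (by omega)]
          · intro h
            exact absurd (Finset.mem_range.2 hbK) h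
        · rw [Finset.sum_eq_zero]
          · linarith
          · intro k hk
            rw [Finset.mem_range] at hk
            rw [p3, if_neg (by omega)]
      rw [e2, e4]
      linarith
  · intro b
    set T := (Finset.range N).filter fun i => (v + r i) % W = b with hT
    have hsub : (((Finset.range (N + m + K)).filter fun i => p i = b).image
        fun i => (f i).color) ⊆ T ∪ if b < v then {N} else ∅ := by
      intro c hc
      obtain ⟨i, hi, rfl⟩ := Finset.mem_image.1 hc
      rw [Finset.mem_filter, Finset.mem_range] at hi
      rw [Finset.mem_union]
      rcases lt_or_ge i N with hiN | hiN
      · left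
        rw [hcol i hiN, hT, Finset.mem_filter, Finset.mem_range, ← p1 i hiN]
        exact ⟨hiN, hi.2⟩
      · obtain ⟨j, rfl⟩ := Nat.exists_eq_add_of_le hiN
        rcases lt_or_ge j m with hj | hj
        · right
          have := hπ j hj
          rw [p2 j hj] at hi
          rw [hredc j hj, if_pos (by omega)]
          exact Finset.mem_singleton_self _
        · left
          obtain ⟨k, rfl⟩ := Nat.exists_eq_add_of_le hj
          rw [← add_assoc] at hi ⊢
          have hk : k < K := by omega
          have hsk := hs k (by omega)
          rw [hbigc k hk, hT, Finset.mem_filter, Finset.mem_range, hsk.2, ← hi.2, p3]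
          exact ⟨hsk.1, Nat.mod_eq_of_lt (by omega)⟩
    refine (Finset.card_le_card hsub).trans ((Finset.card_union_le _ _).trans ?_)
    by_cases hb : b < v
    · have hT1 : T.card ≤ t - 1 := card_filter_mod_le hlt hinj 1 fun i hi h => by
        rw [Nat.one_le_div_iff hW]
        by_contra hlt'
        rw [Nat.mod_eq_of_lt (by omega)] at h
        omega
      have ht : 0 < t := by
        rcases Nat.eq_zero_or_pos t with rfl | h
        · omega
        · exact h
      simp only [hb, if_true, Finset.card_singleton]
      omega
    · have hT1 : T.card ≤ t - 0 := card_filter_mod_le hlt hinj 0 fun i hi h => Nat.zero_le _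
      simp only [hb, if_false, Finset.card_empty]
      omega
  · conv_rhs => rw [← Finset.card_range W]
    refine Finset.card_le_card fun b hb => ?_
    obtain ⟨i, hi, rfl⟩ := Finset.mem_image.1 hb
    rw [Finset.mem_range] at hi ⊢
    rcases lt_or_ge i N with hiN | hiN
    · rw [p1 i hiN]
      exact Nat.mod_lt _ hW
    · obtain ⟨j, rfl⟩ := Nat.exists_eq_add_of_le hiN
      rcases lt_or_ge j m with hj | hj
      · have := hπ j hj
        rw [p2 j hj]
        omega
      · obtain ⟨k, rfl⟩ := Nat.exists_eq_add_of_le hj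
        rw [← add_assoc, p3]
        omega

/-- Offline packing of `N` small items of distinct colors and `S` huge items, such that the huge
items share their bins with items of rank less than `t * S` only. -/
theorem opt_le_of_huge_with_tiny {t N S W : ℕ} {f : ℕ → Item} {δ : ℚ} {r s : ℕ → ℕ}
    (ht : 0 < t) (hδ : 0 ≤ δ) (hS : t * S ≤ N)
    (hr : ∀ i < N, r i < N ∧ s (r i) = i) (hs : ∀ i < N, s i < N ∧ r (s i) = i)
    (hsize : ∑ i ∈ Finset.range N, (f i).size ≤ 1) (hcol : ∀ i < N, (f i).color = i)
    (hsmall : ∀ i < N, r i < t * S → t * (f i).size ≤ δ)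
    (hbigs : ∀ k < S, (f (N + k)).size ≤ 1 - δ)
    (hbigc : ∀ k < S, (f (N + k)).color = s (t * k))
    (hW : N ≤ t * W) : opt t (seqList f (N + S)) ≤ W := by
  classical
  -- Bins are blocks of `t` consecutive ranks. Huge item `k` joins block `k`, which contains the
  -- tiny item of its color, that of rank `t * k`.
  let p : ℕ → ℕ := fun i => if i < N then r i / t else i - N
  have p1 : ∀ i < N, p i = r i / t := fun i hi => by simp [p, hi]
  have p2 : ∀ k, p (N + k) = k := fun k => by simp [p]
  have hinj : ∀ i ∈ Finset.range N, ∀ j ∈ Finset.range N, r i = r j → i = j := by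
    intro i hi j hj h
    rw [← (hr i (Finset.mem_range.1 hi)).2, ← (hr j (Finset.mem_range.1 hj)).2, h]
  have hSW : S ≤ W := Nat.le_of_mul_le_mul_left (hS.trans hW) ht
  refine (opt_seqList_le p ?_ ?_).trans ?_
  · intro b
    rw [Finset.sum_filter, Finset.sum_range_add]
    have e1 : ∑ i ∈ Finset.range N, (if p i = b then (f i).size else 0)
        = ∑ i ∈ Finset.range N with r i / t = b, (f i).size := by
      rw [Finset.sum_filter]
      refine Finset.sum_congr rfl fun i hi => ?_
      rw [p1 i (Finset.mem_range.1 hi)]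
    rw [e1]
    by_cases hb : b < S
    · have e0 : ∑ k ∈ Finset.range S, (if p (N + k) = b then (f (N + k)).size else 0)
          = (f (N + b)).size := by
        rw [Finset.sum_eq_single b, p2, if_pos rfl]
        · intro k _ hk
          rw [p2, if_neg hk]
        · exact fun h => absurd (Finset.mem_range.2 hb) h
      rw [e0]
      have hcard := card_filter_div_le (b := b) ht hinj
      have e2 : (t : ℚ) * ∑ i ∈ Finset.range N with r i / t = b, (f i).size ≤ t * δ := by
        rw [Finset.mul_sum]
        refine (Finset.sum_le_card_nsmul _ _ δ fun i hi => ?_).trans ?_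
        · rw [Finset.mem_filter, Finset.mem_range] at hi
          refine hsmall i hi.1 ?_
          rw [← hi.2] at hb
          rwa [Nat.div_lt_iff_lt_mul ht, mul_comm] at hb
        · rw [nsmul_eq_mul]
          exact mul_le_mul_of_nonneg_right (by exact_mod_cast hcard) hδ
      have e3 := le_of_mul_le_mul_left e2 (by exact_mod_cast ht)
      have := hbigs b hb
      linarith
    · have e2 : ∑ k ∈ Finset.range S, (if p (N + k) = b then (f (N + k)).size else 0) = 0 := by
        refine Finset.sum_eq_zero fun k hk => ?_
        rw [Finset.mem_range] at hk
        rw [p2, if_neg (by omega)]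
      rw [e2, add_zero]
      exact (Finset.sum_le_sum_of_subset_of_nonneg (Finset.filter_subset _ _)
        fun i _ _ => (f i).size_pos.le).trans hsize
  · intro b
    refine le_trans (Finset.card_le_card ?_) (card_filter_div_le (b := b) ht hinj)
    intro c hc
    obtain ⟨i, hi, rfl⟩ := Finset.mem_image.1 hc
    rw [Finset.mem_filter, Finset.mem_range] at hi
    rw [Finset.mem_filter, Finset.mem_range]
    rcases lt_or_ge i N with hiN | hiN
    · rw [hcol i hiN, ← p1 i hiN]
      exact ⟨hiN, hi.2⟩
    · obtain ⟨k, rfl⟩ := Nat.exists_eq_add_of_le hiN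
      have hk : k < S := by omega
      have hlt : t * k < N := lt_of_lt_of_le ((Nat.mul_lt_mul_left ht).2 hk) hS
      have hsk := hs (t * k) hlt
      rw [hbigc k hk, hsk.2, ← hi.2, p2, Nat.mul_div_cancel_left k ht]
      exact ⟨hsk.1, rfl⟩
  · conv_rhs => rw [← Finset.card_range W]
    refine Finset.card_le_card fun b hb => ?_
    obtain ⟨i, hi, rfl⟩ := Finset.mem_image.1 hb
    rw [Finset.mem_range] at hi ⊢
    rcases lt_or_ge i N with hiN | hiN
    · rw [p1 i hiN, Nat.div_lt_iff_lt_mul ht, mul_comm]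
      exact lt_of_lt_of_le (hr i hiN).1 hW
    · obtain ⟨k, rfl⟩ := Nat.exists_eq_add_of_le hiN
      rw [p2]
      omega

/-! ### Full bins and lower bounds on the online cost -/

namespace OnlineAlgorithm

variable {t : ℕ} (A : OnlineAlgorithm t)

/-- The number of the first `N` items that the algorithm puts into bin `b`. -/
def load (f : ℕ → Item) (N b : ℕ) : ℕ := ((Finset.range N).filter fun i => A.binOf f i = b).card

/-- The bins that receive exactly `t` of the first `N` items. -/
def fullBins (f : ℕ → Item) (N : ℕ) : Finset ℕ :=
  ((Finset.range N).image (A.binOf f)).filter fun b => A.load f N b = t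

/-- The indices of the first `N` items whose bins are not full. -/
def nonfullItems (f : ℕ → Item) (N : ℕ) : Finset ℕ :=
  (Finset.range N).filter fun i => A.load f N (A.binOf f i) ≠ t

theorem load_congr {f g : ℕ → Item} {N : ℕ} (h : ∀ i < N, f i = g i) (b : ℕ) :
    A.load f N b = A.load g N b := by
  unfold load
  congr 1
  refine Finset.filter_congr fun i hi => ?_
  rw [A.binOf_congr fun j hj => h j (hj.trans_lt (Finset.mem_range.1 hi))]

theorem image_binOf_congr {f g : ℕ → Item} {N : ℕ} (h : ∀ i < N, f i = g i) :
    (Finset.range N).image (A.binOf f) = (Finset.range N).image (A.binOf g) :=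
  Finset.image_congr fun _ hi =>
    A.binOf_congr fun j hj => h j (hj.trans_lt (Finset.mem_range.1 hi))

theorem fullBins_congr {f g : ℕ → Item} {N : ℕ} (h : ∀ i < N, f i = g i) :
    A.fullBins f N = A.fullBins g N := by
  unfold fullBins
  rw [A.image_binOf_congr h]
  exact Finset.filter_congr fun b _ => by rw [A.load_congr h]

theorem load_le {f : ℕ → Item} {N : ℕ} (hcol : ∀ i < N, (f i).color = i) (b : ℕ) :
    A.load f N b ≤ t := by
  have h := A.card_color_binOf_le f N b
  rwa [Finset.card_image_of_injOn] at h
  intro i hi j hj hij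
  have hi := Finset.mem_range.1 (Finset.mem_filter.1 hi).1
  have hj := Finset.mem_range.1 (Finset.mem_filter.1 hj).1
  simpa only [hcol i hi, hcol j hj] using hij

theorem mul_card_fullBins_add (f : ℕ → Item) (N : ℕ) :
    t * (A.fullBins f N).card + (A.nonfullItems f N).card = N := by
  have h := Finset.card_filter_add_card_filter_not (s := Finset.range N)
    (fun i => A.load f N (A.binOf f i) = t)
  rw [Finset.card_range] at h
  have h1 : ((Finset.range N).filter fun i => A.load f N (A.binOf f i) = t).card
      = t * (A.fullBins f N).card := by
    rw [Finset.card_eq_sum_card_fiberwise (f := A.binOf f) (t := A.fullBins f N)]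
    · rw [mul_comm, ← smul_eq_mul]
      refine Finset.sum_const_nat fun b hb => ?_
      have hb' := (Finset.mem_filter.1 hb).2
      conv_rhs => rw [← hb']
      unfold load
      congr 1
      ext i
      simp only [Finset.mem_filter]
      constructor
      · exact fun hi => ⟨hi.1.1, hi.2⟩
      · rintro ⟨hi, rfl⟩
        exact ⟨⟨hi, hb'⟩, rfl⟩
    · intro i hi
      have hi := Finset.mem_filter.1 hi
      exact Finset.mem_coe.2 (Finset.mem_filter.2 ⟨Finset.mem_image_of_mem _ hi.1, hi.2⟩)
  rw [h1] at h
  exact h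

/-- A bin that is not full has at most `t - 1` tiny items, so few bins force many full ones. -/
theorem le_mul_card_bins_add {f : ℕ → Item} {N : ℕ} (ht : 1 ≤ t)
    (hcol : ∀ i < N, (f i).color = i) :
    N ≤ (t - 1) * ((Finset.range N).image (A.binOf f)).card + (A.fullBins f N).card := by
  have h := Finset.card_eq_sum_card_image (A.binOf f) (Finset.range N)
  rw [Finset.card_range] at h
  refine h.trans_le ?_
  have : ∀ b ∈ (Finset.range N).image (A.binOf f), A.load f N b
      ≤ (t - 1) + if A.load f N b = t then 1 else 0 := by
    intro b _
    have := A.load_le hcol b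
    split_ifs <;> omega
  refine (Finset.sum_le_sum this).trans ?_
  rw [Finset.sum_add_distrib, Finset.sum_const, smul_eq_mul, fullBins, Finset.card_filter, mul_comm]

/-- The tiny items of a full bin exhaust its `t` colors, so any further item repeats one of them.
Since tiny item `i` has color `i`, the color is also the index of the tiny item that it repeats. -/
theorem color_of_mem_full {f : ℕ → Item} {N q : ℕ} (hcol : ∀ i < N, (f i).color = i)
    (hq : A.load f N (A.binOf f q) = t) :
    (f q).color < N ∧ A.binOf f (f q).color = A.binOf f q := by
  set T := (Finset.range N).filter fun i => A.binOf f i = A.binOf f q with hT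
  have hTi : T.image (fun i => (f i).color) = T := by
    conv_rhs => rw [← Finset.image_id (s := T)]
    exact Finset.image_congr fun i hi =>
      hcol i (Finset.mem_range.1 (Finset.mem_filter.1 hi).1)
  by_contra hn
  have hnT : (f q).color ∉ T := by
    rwa [hT, Finset.mem_filter, Finset.mem_range]
  have h := A.card_color_le_of_binOf f (A.binOf f q) (insert q T) (by
    intro i hi
    rcases Finset.mem_insert.1 hi with rfl | hi
    · rfl
    · exact (Finset.mem_filter.1 hi).2)
  rw [Finset.image_insert, hTi, Finset.card_insert_of_notMem hnT] at h
  change T.card = t at hq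
  omega

theorem size_add_size_le {f : ℕ → Item} {i j : ℕ} (hij : i ≠ j)
    (h : A.binOf f i = A.binOf f j) : (f i).size + (f j).size ≤ 1 := by
  have := A.sum_le_one_of_binOf f (A.binOf f j) {i, j} (by simp [h])
  rwa [Finset.sum_pair hij] at this

/-- Full bins, bins with items of the extra color, and bins with huge items of colors of items
outside full bins are all different. -/
theorem card_fullBins_add_le_cost {f : ℕ → Item} {N m K : ℕ} {η : ℚ}
    (hcol : ∀ i < N, (f i).color = i) (hη : 2 * η < 1)
    (hredc : ∀ j < m, (f (N + j)).color = N) (hred : ∀ j < m, η < (f (N + j)).size)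
    (hbig : ∀ k < K, 1 - η ≤ (f (N + m + k)).size)
    (hbigc : ∀ k < K, (f (N + m + k)).color ∈ A.nonfullItems f N) :
    (A.fullBins f N).card + ((Finset.range m).image fun j => A.binOf f (N + j)).card + K
      ≤ A.cost (seqList f (N + m + K)) := by
  rw [cost_seqList]
  set F := A.fullBins f N
  set D := (Finset.range m).image fun j => A.binOf f (N + j)
  set B := (Finset.range K).image fun k => A.binOf f (N + m + k) with hB
  have hFsub : F ⊆ (Finset.range N).image (A.binOf f) := Finset.filter_subset _ _
  have hBcard : B.card = K := by
    rw [hB, Finset.card_image_of_injOn, Finset.card_range]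
    intro i hi j hj hij
    by_contra hne
    have h1 := A.size_add_size_le (i := N + m + i) (j := N + m + j) (by omega) hij
    have h2 := hbig i (Finset.mem_range.1 hi)
    have h3 := hbig j (Finset.mem_range.1 hj)
    linarith
  have hFD : Disjoint F D := by
    rw [Finset.disjoint_left]
    intro b hbF hbD
    obtain ⟨j, hj, rfl⟩ := Finset.mem_image.1 hbD
    have h1 := (A.color_of_mem_full hcol (Finset.mem_filter.1 hbF).2).1
    rw [hredc j (Finset.mem_range.1 hj)] at h1
    exact lt_irrefl _ h1
  have hFDB : Disjoint (F ∪ D) B := by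
    rw [Finset.disjoint_right]
    intro b hbB hb
    obtain ⟨k, hk, rfl⟩ := Finset.mem_image.1 hbB
    have hk := Finset.mem_range.1 hk
    rcases Finset.mem_union.1 hb with hb | hb
    · have h0 := (Finset.mem_filter.1 hb).2
      have h1 := A.color_of_mem_full hcol h0
      have h2 := (Finset.mem_filter.1 (hbigc k hk)).2
      rw [h1.2] at h2
      exact h2 h0
    · obtain ⟨j, hj, hjk⟩ := Finset.mem_image.1 hb
      have hj := Finset.mem_range.1 hj
      have h1 := A.size_add_size_le (i := N + j) (j := N + m + k) (by omega) hjk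
      have h2 := hbig k hk
      have h3 := hred j hj
      linarith
  calc F.card + D.card + K = ((F ∪ D) ∪ B).card := by
        rw [Finset.card_union_of_disjoint hFDB, Finset.card_union_of_disjoint hFD, hBcard]
    _ ≤ _ := by
        refine Finset.card_le_card fun b hb => ?_
        rcases Finset.mem_union.1 hb with hb | hb
        · rcases Finset.mem_union.1 hb with hb | hb
          · obtain ⟨i, hi, rfl⟩ := Finset.mem_image.1 (hFsub hb)
            have := Finset.mem_range.1 hi
            exact Finset.mem_image_of_mem _ (Finset.mem_range.2 (by omega))
          · obtain ⟨j, hj, rfl⟩ := Finset.mem_image.1 hb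
            have := Finset.mem_range.1 hj
            exact Finset.mem_image_of_mem _ (Finset.mem_range.2 (by omega))
        · obtain ⟨k, hk, rfl⟩ := Finset.mem_image.1 hb
          have := Finset.mem_range.1 hk
          exact Finset.mem_image_of_mem _ (Finset.mem_range.2 (by omega))

/-- If every bin contains a large item, then huge items that do not fit with a large item open
new bins. -/
theorem card_bins_add_le_cost {f : ℕ → Item} {N S : ℕ} {δ : ℚ} (hδ : 2 * δ < 1)
    (hlarge : ∀ i < N, ∃ j < N, A.binOf f j = A.binOf f i ∧ δ < (f j).size)
    (hbig : ∀ k < S, 1 - δ ≤ (f (N + k)).size) :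
    ((Finset.range N).image (A.binOf f)).card + S ≤ A.cost (seqList f (N + S)) := by
  rw [cost_seqList]
  set F := (Finset.range N).image (A.binOf f)
  set B := (Finset.range S).image fun k => A.binOf f (N + k) with hB
  have hBcard : B.card = S := by
    rw [hB, Finset.card_image_of_injOn, Finset.card_range]
    intro i hi j hj hij
    by_contra hne
    have h1 := A.size_add_size_le (i := N + i) (j := N + j) (by omega) hij
    have h2 := hbig i (Finset.mem_range.1 hi)
    have h3 := hbig j (Finset.mem_range.1 hj)
    linarith
  have hFB : Disjoint F B := by
    rw [Finset.disjoint_left]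
    intro b hbF hbB
    obtain ⟨i, hi, rfl⟩ := Finset.mem_image.1 hbF
    obtain ⟨k, hk, hki⟩ := Finset.mem_image.1 hbB
    obtain ⟨j, hj, hji, hjs⟩ := hlarge i (Finset.mem_range.1 hi)
    have h1 := A.size_add_size_le (i := j) (j := N + k) (by omega) (hji.trans hki.symm)
    have h2 := hbig k (Finset.mem_range.1 hk)
    linarith
  calc F.card + S = (F ∪ B).card := by rw [Finset.card_union_of_disjoint hFB, hBcard]
    _ ≤ _ := by
        refine Finset.card_le_card fun b hb => ?_
        rcases Finset.mem_union.1 hb with hb | hb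
        · obtain ⟨i, hi, rfl⟩ := Finset.mem_image.1 hb
          have := Finset.mem_range.1 hi
          exact Finset.mem_image_of_mem _ (Finset.mem_range.2 (by omega))
        · obtain ⟨k, hk, rfl⟩ := Finset.mem_image.1 hb
          have := Finset.mem_range.1 hk
          exact Finset.mem_image_of_mem _ (Finset.mem_range.2 (by omega))

end OnlineAlgorithm

/-! ### The phase of tiny items -/

/-- The `n` steps of an adaptive sequence can be labelled below `4 ^ n` such that a cut separates
the steps of the class from the other steps. -/
theorem exists_labels_cut (n : ℕ) (P : (ℕ → ℕ) → ℕ → Prop)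
    (hP : ∀ e e' i, (∀ j ≤ i, e j = e' j) → (P e i ↔ P e' i)) :
    ∃ (e : ℕ → ℕ) (c : ℕ), c ≤ 4 ^ n ∧ (∀ i < n, e i < 4 ^ n) ∧
      (∀ i < n, P e i → c ≤ e i) ∧ ∀ i < n, ¬ P e i → e i < c := by
  classical
  obtain ⟨e, he, hsep⟩ := exists_separating_labels n 0 P hP
  simp only [zero_add] at he
  refine ⟨e, ((Finset.range n).filter fun i => ¬ P e i).sup fun i => e i + 1, ?_,
    fun i hi => (he i hi).2, ?_, ?_⟩
  · exact Finset.sup_le fun i hi =>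
      (he i (Finset.mem_range.1 (Finset.mem_filter.1 hi).1)).2
  · intro i hi hPi
    refine Finset.sup_le fun j hj => ?_
    have hj := Finset.mem_filter.1 hj
    exact hsep i hi j (Finset.mem_range.1 hj.1) hPi hj.2
  · intro i hi hPi
    exact Finset.le_sup (f := fun i => e i + 1)
      (Finset.mem_filter.2 ⟨Finset.mem_range.2 hi, hPi⟩)

/-- The first occurrences of the values of a sequence are as many as its values. -/
theorem card_filter_first (β : ℕ → ℕ) (N : ℕ) :
    ((Finset.range N).filter fun i => β i ∉ (Finset.range i).image β).card
      = ((Finset.range N).image β).card := by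
  induction N with
  | zero => rfl
  | succ N ih =>
    rw [Finset.range_add_one, Finset.filter_insert, Finset.image_insert]
    by_cases h : β N ∈ (Finset.range N).image β
    · rw [if_neg (not_not.2 h), Finset.insert_eq_of_mem h, ih]
    · rw [if_pos h, Finset.card_insert_of_notMem (by simp), Finset.card_insert_of_notMem h, ih]

/-- Provides the opener of the bin of `i`, the item whose size is controlled by the adaptive labels.
-/
theorem exists_first (β : ℕ → ℕ) (i : ℕ) :
    ∃ j ≤ i, β j = β i ∧ β j ∉ (Finset.range j).image β := by
  have h : ∃ j, β j = β i := ⟨i, rfl⟩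
  refine ⟨Nat.find h, Nat.find_le rfl, Nat.find_spec h, fun hm => ?_⟩
  obtain ⟨k, hk, hkj⟩ := Finset.mem_image.1 hm
  exact Nat.find_min h (Finset.mem_range.1 hk) (hkj.trans (Nat.find_spec h))

namespace OnlineAlgorithm

variable {t : ℕ} (A : OnlineAlgorithm t)

/-- Adaptive input of `N` tiny items of distinct colors: the items that open a bin are more than
`t` times as large as all other items. -/
theorem exists_tiny_phase {N : ℕ} (htN : t ≤ N) (hN : 0 < N) {η : ℚ} (hη : 0 < η)
    (hη1 : η ≤ 1) :
    ∃ (g : ℕ → Item) (δ : ℚ), (∀ i, (g i).color = i) ∧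
      ∑ i ∈ Finset.range N, (g i).size ≤ η ∧ 0 ≤ δ ∧ δ ≤ η ∧
      (∀ i < N, A.binOf g i ∉ (Finset.range i).image (A.binOf g) → δ < (g i).size) ∧
      ∀ i < N, A.binOf g i ∈ (Finset.range i).image (A.binOf g) → t * (g i).size ≤ δ := by
  have hN0 : (0 : ℚ) < N := by exact_mod_cast hN
  have hN1 : (1 : ℚ) ≤ N := by exact_mod_cast hN
  have ht0 : (0 : ℚ) ≤ t := Nat.cast_nonneg t
  -- Each label step shrinks the size by the factor `t + 1`, which exceeds `t`; the cap `η / N`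
  -- bounds the total by `η`. The class in the labelling is that of the items that open no bin:
  -- large labels mean small sizes.
  let sz : ℕ → ℚ := fun k => η / N / (t + 1) ^ k
  have hθ : 0 < η / N := by positivity
  have hsz0 : ∀ k, 0 < sz k := fun k => by positivity
  have hsz1 : ∀ k, sz k ≤ η / N := fun k =>
    div_le_self hθ.le (one_le_pow₀ (by linarith))
  have hθ1 : η / N ≤ 1 := by
    rw [div_le_one hN0]
    linarith
  let g : (ℕ → ℕ) → ℕ → Item := fun e i => mkItem (sz (e i)) i
  have hgs : ∀ e i, (g e i).size = sz (e i) := fun e i =>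
    mkItem_size (hsz0 _) ((hsz1 _).trans hθ1)
  obtain ⟨e, c, -, -, h1, h2⟩ := exists_labels_cut N
    (fun e i => A.binOf (g e) i ∈ (Finset.range i).image (A.binOf (g e))) (by
      intro e e' i h
      have hg : ∀ j ≤ i, g e j = g e' j := fun j hj => by simp only [g, h j hj]
      rw [A.binOf_congr hg, A.image_binOf_congr fun j hj => hg j hj.le])
  have hanti : ∀ k l, k ≤ l → sz l ≤ sz k := fun k l hkl =>
    div_le_div_of_nonneg_left hθ.le (by positivity)
      (pow_le_pow_right₀ (by linarith) hkl)
  -- The threshold is `t` times the size at the cut: non-openers have labels at least `c`, openers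
  -- are at least one label step, a factor `t + 1`, larger.
  refine ⟨g e, t * sz c, fun i => mkItem_color _ _, ?_, ?_, ?_, ?_, ?_⟩
  · calc ∑ i ∈ Finset.range N, (g e i).size ≤ ∑ _i ∈ Finset.range N, η / N :=
          Finset.sum_le_sum fun i _ => by rw [hgs]; exact hsz1 _
      _ = η := by
          rw [Finset.sum_const, Finset.card_range, nsmul_eq_mul]
          field_simp
  · exact mul_nonneg ht0 (hsz0 c).le
  · calc (t : ℚ) * sz c ≤ N * (η / N) :=
          mul_le_mul (by exact_mod_cast htN) (hsz1 c) (hsz0 c).le hN0.le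
      _ = η := by field_simp
  · intro i hi hfirst
    have hlt := h2 i hi hfirst
    rw [hgs]
    calc (t : ℚ) * sz c < (t + 1) * sz c := by
          have := hsz0 c
          linarith
      _ = sz c * (t + 1) := mul_comm _ _
      _ ≤ sz (e i + 1) * (t + 1) :=
          mul_le_mul_of_nonneg_right (hanti _ _ hlt) (by linarith)
      _ = sz (e i) := by
          simp only [sz]
          rw [pow_succ]
          field_simp
  · intro i hi hmem
    rw [hgs]
    exact mul_le_mul_of_nonneg_left (hanti _ _ (h1 i hi hmem)) ht0

/-- Lower bound from huge items that cannot join the bins of the tiny items. -/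
theorem ineq_of_tiny_phase {R : ℝ} (hR : 0 ≤ R) {Q₀ N : ℕ} (ht : 1 ≤ t)
    (H : ∀ I : List Item, Q₀ ≤ opt t I → (A.cost I : ℝ) ≤ R * opt t I)
    (hN : t * Q₀ ≤ N) {g : ℕ → Item} {δ : ℚ}
    (hcol : ∀ i, (g i).color = i) (hsize : ∑ i ∈ Finset.range N, (g i).size ≤ 1)
    (hδ : 0 ≤ δ) (hδ1 : 2 * δ < 1)
    (hlarge : ∀ i < N, A.binOf g i ∉ (Finset.range i).image (A.binOf g) → δ < (g i).size)
    (hsmall : ∀ i < N, A.binOf g i ∈ (Finset.range i).image (A.binOf g) →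
      t * (g i).size ≤ δ) :
    (((Finset.range N).image (A.binOf g)).card : ℝ)
      + ((N - ((Finset.range N).image (A.binOf g)).card) / t - 1) ≤ R * (N / t + 1) := by
  set X := ((Finset.range N).image (A.binOf g)).card with hX
  set D := (Finset.range N).filter fun i => A.binOf g i ∈ (Finset.range i).image (A.binOf g)
    with hD
  have hDX : D.card + X = N := by
    rw [hX, ← card_filter_first, hD, Finset.card_filter_add_card_filter_not, Finset.card_range]
  -- Non-openers get the smallest ranks, so that they fill the bins of the huge items.
  obtain ⟨r, s, hr, hs, hrD⟩ := exists_rank (N := N) D fun i hi =>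
    Finset.mem_range.1 (Finset.mem_filter.1 hi).1
  set S := D.card / t with hS
  have hSD : t * S ≤ D.card := Nat.mul_div_le _ _
  have htR : (0 : ℝ) < t := by exact_mod_cast ht
  let f : ℕ → Item := fun i => if i < N then g i else mkItem (1 - δ) (s (t * (i - N)))
  have hfg : ∀ i < N, f i = g i := fun i hi => by simp [f, hi]
  have hfb : ∀ k, f (N + k) = mkItem (1 - δ) (s (t * k)) := fun k => by simp [f]
  have hbs : ∀ k, (f (N + k)).size = 1 - δ := fun k => by
    rw [hfb, mkItem_size (by linarith) (by linarith)]
  have hfcol : ∀ i < N, (f i).color = i := fun i hi => by rw [hfg i hi, hcol]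
  have hbin : ∀ i < N, A.binOf f i = A.binOf g i := fun i hi =>
    A.binOf_congr fun j hj => hfg j (hj.trans_lt hi)
  have hcost := A.card_bins_add_le_cost (f := f) (N := N) (S := S) hδ1 (by
      intro i hi
      obtain ⟨j, hji, hj, hjf⟩ := exists_first (A.binOf g) i
      have hjN : j < N := hji.trans_lt hi
      exact ⟨j, hjN, by rw [hbin j hjN, hbin i hi, hj], by
        rw [hfg j hjN]; exact hlarge j hjN hjf⟩)
    (fun k _ => (hbs k).ge)
  have hopt : opt t (seqList f (N + S)) ≤ N / t + 1 := by
    refine opt_le_of_huge_with_tiny (δ := δ) ht hδ (by omega) hr hs ?_ hfcol ?_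
      (fun k _ => (hbs k).le) (fun k _ => by rw [hfb, mkItem_color]) ?_
    · rwa [Finset.sum_congr rfl fun i hi => by rw [hfg i (Finset.mem_range.1 hi)]]
    · intro i hi hri
      rw [hfg i hi]
      have : i ∈ D := (hrD i hi).2 (by omega)
      exact hsmall i hi (Finset.mem_filter.1 this).2
    · exact (Nat.lt_mul_div_succ N ht).le
  have hQ : Q₀ ≤ opt t (seqList f (N + S)) :=
    Nat.le_of_mul_le_mul_left (hN.trans (le_mul_opt ht (Nat.le_add_right _ _) hfcol)) ht
  have h1 := H _ hQ
  rw [A.image_binOf_congr hfg] at hcost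
  have h2 : (X : ℝ) + S ≤ A.cost (seqList f (N + S)) := by exact_mod_cast hcost
  have h3 : (opt t (seqList f (N + S)) : ℝ) ≤ N / t + 1 := by
    have h4 : (opt t (seqList f (N + S)) : ℝ) ≤ ((N / t : ℕ) : ℝ) + 1 := by exact_mod_cast hopt
    have h5 : ((N / t : ℕ) : ℝ) ≤ N / t := Nat.cast_div_le
    linarith
  have h6 : ((N : ℝ) - X) / t - 1 ≤ S := by
    have h7 : D.card < t * (S + 1) := Nat.lt_mul_div_succ _ ht
    have h8 : (D.card : ℝ) < t * (S + 1) := by exact_mod_cast h7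
    have h9 : (D.card : ℝ) + X = N := by exact_mod_cast hDX
    rw [sub_le_iff_le_add, div_le_iff₀ htR]
    linarith
  have h7 := mul_le_mul_of_nonneg_left h3 hR
  linarith

/-! ### Items of one extra color -/

/-- The sequence `g` up to index `N`, followed by items of color `N` of sizes `ρ 0, ρ 1, …`. -/
def extend (g : ℕ → Item) (N : ℕ) (ρ : ℕ → ℚ) : ℕ → Item := fun i =>
  if i < N then g i else mkItem (ρ (i - N)) N

/-- The bins that receive one of the `m` items of the extra color. -/
def extraBins (g : ℕ → Item) (N : ℕ) (ρ : ℕ → ℚ) (m : ℕ) : Finset ℕ :=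
  (Finset.range m).image fun j => A.binOf (extend g N ρ) (N + j)

/-- Lower bound from tiny items, items of an extra color that can be packed into `v` bins, and
`K` huge items of the colors of tiny items outside full bins. -/
theorem ineq_of_extra {R : ℝ} (hR : 0 ≤ R) {Q₀ N : ℕ} (ht : 1 ≤ t)
    (H : ∀ I : List Item, Q₀ ≤ opt t I → (A.cost I : ℝ) ≤ R * opt t I)
    (hN : t * Q₀ ≤ N) {g : ℕ → Item} {η : ℚ}
    (hcol : ∀ i, (g i).color = i) (hη : 0 ≤ η) (hη1 : 2 * η < 1)
    (hsize : ∑ i ∈ Finset.range N, (g i).size ≤ η)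
    {ρ : ℕ → ℚ} {m v K : ℕ} {π : ℕ → ℕ}
    (hρ : ∀ j < m, η < ρ j ∧ ρ j ≤ 1) (hπ : ∀ j < m, π j < v)
    (hfit : ∀ b < v, ∑ j ∈ Finset.range m with π j = b, ρ j ≤ 1 - η)
    (hK : K ≤ (A.nonfullItems g N).card) (hKv : t * K + (t - 1) * v ≤ N) :
    ((A.fullBins g N).card : ℝ) + (A.extraBins g N ρ m).card + K
      ≤ R * ((N + v : ℝ) / t + 1) := by
  have htR : (0 : ℝ) < t := by exact_mod_cast ht
  obtain ⟨D, hDs, hDK⟩ := Finset.exists_subset_card_eq hK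
  have hDN : ∀ i ∈ D, i < N := fun i hi =>
    Finset.mem_range.1 (Finset.mem_filter.1 (hDs hi)).1
  obtain ⟨r, s, hr, hs, hrD⟩ := exists_rank (N := N) D hDN
  have hKN : K ≤ N := by
    have := Nat.le_mul_of_pos_left K ht
    omega
  let f : ℕ → Item := fun i =>
    if i < N + m then extend g N ρ i else mkItem (1 - η) (s (i - (N + m)))
  have hfe : ∀ i < N + m, f i = extend g N ρ i := fun i hi => by simp [f, hi]
  have hfg : ∀ i < N, f i = g i := fun i hi => by
    rw [hfe i (by omega)]
    simp [extend, hi]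
  have hfr : ∀ j < m, f (N + j) = mkItem (ρ j) N := fun j hj => by
    rw [hfe _ (by omega)]
    simp [extend]
  have hfb : ∀ k, f (N + m + k) = mkItem (1 - η) (s k) := fun k => by simp [f]
  have hrs : ∀ j < m, (f (N + j)).size = ρ j := fun j hj => by
    rw [hfr j hj, mkItem_size (hη.trans_lt (hρ j hj).1) (hρ j hj).2]
  have hbs : ∀ k, (f (N + m + k)).size = 1 - η := fun k => by
    rw [hfb, mkItem_size (by linarith) (by linarith)]
  have hfcol : ∀ i < N, (f i).color = i := fun i hi => by rw [hfg i hi, hcol]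
  have hredc : ∀ j < m, (f (N + j)).color = N := fun j hj => by rw [hfr j hj, mkItem_color]
  have hbc : ∀ k < K, (f (N + m + k)).color = s k := fun k _ => by rw [hfb, mkItem_color]
  have hnf : A.nonfullItems f N = A.nonfullItems g N := by
    unfold nonfullItems
    refine Finset.filter_congr fun i hi => ?_
    rw [A.load_congr hfg,
      A.binOf_congr fun j hj => hfg j (hj.trans_lt (Finset.mem_range.1 hi))]
  have hcost := A.card_fullBins_add_le_cost (f := f) (N := N) (m := m) (K := K) (η := η)
    hfcol hη1 hredc (fun j hj => by rw [hrs j hj]; exact (hρ j hj).1) (fun k _ => (hbs k).ge) (by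
      intro k hk
      rw [hbc k hk, hnf]
      have hsk := hs k (by omega)
      refine hDs ((hrD _ hsk.1).2 ?_)
      rw [hsk.2, hDK]
      exact hk)
  have hext : ((Finset.range m).image fun j => A.binOf f (N + j)) = A.extraBins g N ρ m :=
    Finset.image_congr fun j hj => A.binOf_congr fun i hi => hfe i (by
      have := Finset.mem_range.1 hj
      omega)
  rw [hext, A.fullBins_congr hfg] at hcost
  have hWt : N + v < t * ((N + v) / t + 1) := Nat.lt_mul_div_succ _ ht
  -- The `v` bins of the extra color and the `K` bins of huge items have no more color slots than
  -- the `N` tiny colors and `v` copies of the extra color fill, so they fit among the `(N + v) / t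
  -- + 1` bins.
  have hvK : t * (v + K) ≤ N + v := by
    obtain ⟨u, rfl⟩ := Nat.exists_eq_add_of_le ht
    simp only [Nat.add_sub_cancel_left] at hKv
    nlinarith
  have hopt : opt t (seqList f (N + m + K)) ≤ (N + v) / t + 1 := by
    refine opt_le_of_huge (η := η) (π := π) (r := r) (s := s) (by linarith) (Nat.succ_pos _)
      hKN hr hs ?_ hfcol hredc hπ ?_ (fun k _ => (hbs k).le) hbc ?_ hWt.le
    · rwa [Finset.sum_congr rfl fun i hi => by rw [hfg i (Finset.mem_range.1 hi)]]
    · intro b hb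
      refine le_trans (le_of_eq (Finset.sum_congr rfl fun j hj => ?_)) (hfit b hb)
      exact hrs j (Finset.mem_range.1 (Finset.mem_filter.1 hj).1)
    · exact (Nat.lt_of_mul_lt_mul_left (hvK.trans_lt hWt)).le
  have hQ : Q₀ ≤ opt t (seqList f (N + m + K)) :=
    Nat.le_of_mul_le_mul_left (hN.trans (le_mul_opt ht (by omega) hfcol)) ht
  have h1 := H _ hQ
  have h2 : ((A.fullBins g N).card : ℝ) + (A.extraBins g N ρ m).card + K
      ≤ A.cost (seqList f (N + m + K)) := by exact_mod_cast hcost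
  have h3 : (opt t (seqList f (N + m + K)) : ℝ) ≤ (N + v : ℝ) / t + 1 := by
    have h4 : (opt t (seqList f (N + m + K)) : ℝ) ≤ (((N + v) / t : ℕ) : ℝ) + 1 := by
      exact_mod_cast hopt
    have h5 : (((N + v) / t : ℕ) : ℝ) ≤ ((N + v : ℕ) : ℝ) / t := Nat.cast_div_le
    push_cast at h5
    linarith
  exact h2.trans (h1.trans (mul_le_mul_of_nonneg_left h3 hR))

end OnlineAlgorithm

/-! ### Bin contents and the weight inequality -/

/-- At most `c` indices share the quotient `u`, as `q` is injective. This is the volume check for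
bins of an explicit packing. -/
theorem sum_filter_le_mul {n c b u : ℕ} {x : ℚ} {w : ℕ → ℚ} {π q : ℕ → ℕ} (hc : 0 < c)
    (hx : 0 ≤ x) (hw : ∀ j < n, π j = b → w j ≤ x)
    (hinj : ∀ i < n, ∀ j < n, q i = q j → i = j) (hq : ∀ j < n, π j = b → q j / c = u) :
    ∑ j ∈ Finset.range n with π j = b, w j ≤ c * x := by
  have hcard : ((Finset.range n).filter fun j => π j = b).card ≤ c := by
    refine le_trans (Finset.card_le_card ?_) (card_filter_div_le (A := Finset.range n) (b := u)
      hc fun i hi j hj => hinj i (Finset.mem_range.1 hi) j (Finset.mem_range.1 hj))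
    intro j hj
    rw [Finset.mem_filter, Finset.mem_range] at hj ⊢
    exact ⟨hj.1, hq j hj.1 hj.2⟩
  refine (Finset.sum_le_card_nsmul _ _ x fun j hj => ?_).trans ?_
  · rw [Finset.mem_filter, Finset.mem_range] at hj
    exact hw j hj.1 hj.2
  · rw [nsmul_eq_mul]
    exact mul_le_mul_of_nonneg_right (by exact_mod_cast hcard) hx

theorem sum_filter_eq_zero_of_ne {n b : ℕ} {w : ℕ → ℚ} {π : ℕ → ℕ} (h : ∀ j < n, π j ≠ b) :
    ∑ j ∈ Finset.range n with π j = b, w j = 0 :=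
  Finset.sum_eq_zero fun j hj => by
    rw [Finset.mem_filter, Finset.mem_range] at hj
    exact absurd hj.2 (h j hj.1)

theorem sum_range_add_filter {n m b : ℕ} (w : ℕ → ℚ) (π : ℕ → ℕ) :
    ∑ j ∈ Finset.range (n + m) with π j = b, w j
      = ∑ j ∈ Finset.range n with π j = b, w j
        + ∑ j ∈ Finset.range m with π (n + j) = b, w (n + j) := by
  rw [Finset.sum_filter, Finset.sum_range_add, Finset.sum_filter, Finset.sum_filter]

/-- The number of indices below `n` that are sent to `b`. -/
def lowCount (β : ℕ → ℕ) (n b : ℕ) : ℕ := ((Finset.range n).filter fun j => β j = b).card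

/-- The number of indices from `n` on and below `2 * n` that are sent to `b`. -/
def highCount (β : ℕ → ℕ) (n b : ℕ) : ℕ :=
  ((Finset.range n).filter fun j => β (n + j) = b).card

theorem sum_lowCount {β : ℕ → ℕ} {n : ℕ} {T : Finset ℕ} (hT : ∀ j < n, β j ∈ T) :
    ∑ b ∈ T, lowCount β n b = n := by
  have h := Finset.card_eq_sum_card_fiberwise (f := β) (s := Finset.range n) (t := T)
    fun j hj => hT j (Finset.mem_range.1 hj)
  rw [Finset.card_range] at h
  exact h.symm

theorem sum_highCount {β : ℕ → ℕ} {n : ℕ} {T : Finset ℕ} (hT : ∀ j < n, β (n + j) ∈ T) :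
    ∑ b ∈ T, highCount β n b = n :=
  sum_lowCount (β := fun j => β (n + j)) hT

theorem lowCount_pos_iff {β : ℕ → ℕ} {n b : ℕ} :
    0 < lowCount β n b ↔ b ∈ (Finset.range n).image β := by
  rw [lowCount, Finset.card_pos, Finset.filter_nonempty_iff, Finset.mem_image]

/-- The occupied bins that can receive a third-phase item of the first kind. -/
def ableA (β : ℕ → ℕ) (n : ℕ) : Finset ℕ :=
  ((Finset.range (n + n)).image β).filter fun b =>
    (highCount β n b = 0 ∧ lowCount β n b ≤ 3) ∨ (highCount β n b = 1 ∧ lowCount β n b ≤ 1)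

/-- The occupied bins that can receive a third-phase item of the second kind. -/
def ableB (β : ℕ → ℕ) (n : ℕ) : Finset ℕ :=
  ((Finset.range (n + n)).image β).filter fun b => highCount β n b = 0 ∧ lowCount β n b ≤ 2

theorem sum_low_add_high (β : ℕ → ℕ) (n : ℕ) : ∑ b ∈ (Finset.range (n + n)).image β,
    (lowCount β n b + 2 * highCount β n b) = 3 * n := by
  rw [Finset.sum_add_distrib, ← Finset.mul_sum, sum_lowCount, sum_highCount]
  · omega
  · exact fun j hj => Finset.mem_image_of_mem _ (Finset.mem_range.2 (by omega))
  · exact fun j hj => Finset.mem_image_of_mem _ (Finset.mem_range.2 (by omega))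

theorem card_image_eq_sum_ite (β : ℕ → ℕ) (n : ℕ) : ((Finset.range n).image β).card
    = ∑ b ∈ (Finset.range (n + n)).image β, if 0 < lowCount β n b then 1 else 0 := by
  rw [← Finset.card_filter]
  congr 1
  ext b
  rw [Finset.mem_filter, lowCount_pos_iff]
  refine ⟨fun h => ⟨?_, h⟩, fun h => h.2⟩
  exact Finset.image_subset_image (Finset.range_mono (by omega)) h

/-- The inequality holds bin by bin. Give a bin with `k` low and `j` high items the weight `k + 2 *
j`, plus `2` for each kind of third-phase item that it can receive. The weight is at most `4`, and
at most `6` if `k > 0`. -/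
theorem weight_ineq {β : ℕ → ℕ} {n : ℕ}
    (hcap : ∀ b, highCount β n b ≤ 2 ∧ (highCount β n b = 0 → lowCount β n b ≤ 6) ∧
      (highCount β n b = 1 → lowCount β n b ≤ 4) ∧
      (highCount β n b = 2 → lowCount β n b ≤ 2)) :
    3 * n + 2 * (ableA β n).card + 2 * (ableB β n).card
      ≤ 2 * ((Finset.range n).image β).card + 4 * ((Finset.range (n + n)).image β).card := by
  rw [← sum_low_add_high β n, card_image_eq_sum_ite β n, ableA, ableB,
    Finset.card_filter, Finset.card_filter, Finset.card_eq_sum_ones ((Finset.range (n + n)).image β),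
    Finset.mul_sum, Finset.mul_sum, Finset.mul_sum, Finset.mul_sum, ← Finset.sum_add_distrib,
    ← Finset.sum_add_distrib, ← Finset.sum_add_distrib]
  refine Finset.sum_le_sum fun b _ => ?_
  obtain ⟨h1, h2, h3, h4⟩ := hcap b
  generalize highCount β n b = j at *
  generalize lowCount β n b = k at *
  interval_cases j <;> simp at h2 h3 h4 ⊢ <;> split_ifs <;> omega

/-! ### Bins of the extra color -/

namespace OnlineAlgorithm

variable {t : ℕ} (A : OnlineAlgorithm t)

/-- The bin of the `j`-th item of the extra color. -/
def extraBin (g : ℕ → Item) (N : ℕ) (ρ : ℕ → ℚ) (j : ℕ) : ℕ := A.binOf (extend g N ρ) (N + j)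

theorem extraBins_eq (g : ℕ → Item) (N : ℕ) (ρ : ℕ → ℚ) (m : ℕ) :
    A.extraBins g N ρ m = (Finset.range m).image (A.extraBin g N ρ) := rfl

theorem extraBin_congr {g : ℕ → Item} {N : ℕ} {ρ ρ' : ℕ → ℚ} {j : ℕ} (h : ∀ i ≤ j, ρ i = ρ' i) :
    A.extraBin g N ρ j = A.extraBin g N ρ' j := by
  refine A.binOf_congr fun i hi => ?_
  unfold extend
  split_ifs
  · rfl
  · rw [h _ (by omega)]

theorem sum_extra_le {g : ℕ → Item} {N m : ℕ} {ρ : ℕ → ℚ} (hρ : ∀ j < m, 0 < ρ j ∧ ρ j ≤ 1)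
    (b : ℕ) : ∑ j ∈ Finset.range m with A.extraBin g N ρ j = b, ρ j ≤ 1 := by
  have h := A.sum_le_one_of_binOf (extend g N ρ) b
    (((Finset.range m).filter fun j => A.extraBin g N ρ j = b).image fun j => N + j) (by
      intro i hi
      obtain ⟨j, hj, rfl⟩ := Finset.mem_image.1 hi
      exact (Finset.mem_filter.1 hj).2)
  rw [Finset.sum_image fun i _ j _ hij => Nat.add_left_cancel hij] at h
  refine le_trans (le_of_eq (Finset.sum_congr rfl fun j hj => ?_)) h
  have hj := hρ j (Finset.mem_range.1 (Finset.mem_filter.1 hj).1)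
  simp only [extend, Nat.add_sub_cancel_left, if_neg (Nat.not_lt.2 (Nat.le_add_right N j))]
  rw [mkItem_size hj.1 hj.2]

theorem capacity {g : ℕ → Item} {N n m : ℕ} {ρ : ℕ → ℚ} {x y : ℚ}
    (hρ : ∀ j < n + n + m, 0 < ρ j ∧ ρ j ≤ 1) (hx : ∀ j < n, x ≤ ρ j)
    (hy : ∀ j < n, y ≤ ρ (n + j)) (b : ℕ) :
    lowCount (A.extraBin g N ρ) n b * x + highCount (A.extraBin g N ρ) n b * y
      + ∑ j ∈ Finset.range m with A.extraBin g N ρ (n + n + j) = b, ρ (n + n + j) ≤ 1 := by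
  have h := A.sum_extra_le (g := g) (N := N) hρ b
  rw [sum_range_add_filter, sum_range_add_filter] at h
  have h1 : lowCount (A.extraBin g N ρ) n b * x
      ≤ ∑ j ∈ Finset.range n with A.extraBin g N ρ j = b, ρ j := by
    rw [lowCount, ← nsmul_eq_mul]
    exact Finset.card_nsmul_le_sum _ _ _ fun j hj =>
      hx j (Finset.mem_range.1 (Finset.mem_filter.1 hj).1)
  have h2 : highCount (A.extraBin g N ρ) n b * y
      ≤ ∑ j ∈ Finset.range n with A.extraBin g N ρ (n + j) = b, ρ (n + j) := by
    rw [highCount, ← nsmul_eq_mul]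
    exact Finset.card_nsmul_le_sum _ _ _ fun j hj =>
      hy j (Finset.mem_range.1 (Finset.mem_filter.1 hj).1)
  linarith

/-- Items larger than `1 / 2` open new bins except for those bins that can receive one. -/
theorem card_extraBins_add_le {g : ℕ → Item} {N m k : ℕ} {ρ : ℕ → ℚ} {S : Finset ℕ}
    (hbig : ∀ j < k, 1 / 2 < ρ (m + j) ∧ ρ (m + j) ≤ 1)
    (hS : ∀ j < k, A.extraBin g N ρ (m + j) ∈ A.extraBins g N ρ m →
      A.extraBin g N ρ (m + j) ∈ S) :
    (A.extraBins g N ρ m).card + k ≤ (A.extraBins g N ρ (m + k)).card + S.card := by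
  set T := A.extraBins g N ρ m with hT
  set B := (Finset.range k).image fun j => A.extraBin g N ρ (m + j) with hB
  have hsz : ∀ j < k, (extend g N ρ (N + (m + j))).size = ρ (m + j) := fun j hj => by
    have := hbig j hj
    simp only [extend, Nat.add_sub_cancel_left, if_neg (Nat.not_lt.2 (Nat.le_add_right N (m + j)))]
    rw [mkItem_size (by linarith) this.2]
  have hBcard : B.card = k := by
    rw [hB, Finset.card_image_of_injOn, Finset.card_range]
    intro i hi j hj hij
    by_contra hne
    have hi := Finset.mem_range.1 hi
    have hj := Finset.mem_range.1 hj
    have h1 := A.size_add_size_le (i := N + (m + i)) (j := N + (m + j)) (by omega) hij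
    rw [hsz i hi, hsz j hj] at h1
    have h2 := hbig i hi
    have h3 := hbig j hj
    linarith
  have hTB : A.extraBins g N ρ (m + k) = T ∪ B := by
    ext b
    rw [hT, hB, extraBins_eq, extraBins_eq, Finset.mem_union]
    simp only [Finset.mem_image, Finset.mem_range]
    constructor
    · rintro ⟨j, hj, rfl⟩
      rcases lt_or_ge j m with h | h
      · exact Or.inl ⟨j, h, rfl⟩
      · exact Or.inr ⟨j - m, by omega, by rw [Nat.add_sub_cancel' h]⟩
    · rintro (⟨j, hj, rfl⟩ | ⟨j, hj, rfl⟩)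
      · exact ⟨j, by omega, rfl⟩
      · exact ⟨m + j, by omega, rfl⟩
  have hint : T ∩ B ⊆ S := by
    intro b hb
    obtain ⟨hbT, hbB⟩ := Finset.mem_inter.1 hb
    obtain ⟨j, hj, rfl⟩ := Finset.mem_image.1 hbB
    exact hS j (Finset.mem_range.1 hj) hbT
  have h1 := Finset.card_union_add_card_inter T B
  have h2 := Finset.card_le_card hint
  rw [hTB]
  omega

end OnlineAlgorithm

/-! ### Low, high and third-phase sizes -/

/-- Sizes of the items of the extra color: `n` items slightly larger than `1 / 7`, then `n` items
slightly larger than `1 / 3` that are fine-tuned by the labels `e`, then items of size `τ`. -/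
def extraSize (n : ℕ) (ε : ℚ) (e : ℕ → ℕ) (τ : ℚ) (j : ℕ) : ℚ :=
  if j < n then 1007 / 7000 else if j < n + n then 1 / 3 + ε * (e (j - n) + 1) else τ

theorem extraSize_low {n : ℕ} {ε : ℚ} {e : ℕ → ℕ} {τ : ℚ} {j : ℕ} (hj : j < n) :
    extraSize n ε e τ j = 1007 / 7000 := by simp [extraSize, hj]

theorem extraSize_high {n : ℕ} {ε : ℚ} {e : ℕ → ℕ} {τ : ℚ} {j : ℕ} (hj : j < n) :
    extraSize n ε e τ (n + j) = 1 / 3 + ε * (e j + 1) := by simp [extraSize, hj]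

theorem extraSize_tail {n : ℕ} {ε : ℚ} {e : ℕ → ℕ} {τ : ℚ} {j : ℕ} :
    extraSize n ε e τ (n + n + j) = τ := by
  have h1 : ¬ n + n + j < n := by omega
  have h2 : ¬ n + n + j < n + n := by omega
  simp [extraSize, h1, h2]

theorem extraSize_congr {n : ℕ} {ε : ℚ} {e e' : ℕ → ℕ} {τ τ' : ℚ} {k : ℕ} (hk : k ≤ n)
    (h : ∀ i < k, e i = e' i) {j : ℕ} (hj : j < n + k) :
    extraSize n ε e τ j = extraSize n ε e' τ' j := by
  unfold extraSize
  split_ifs with h1 h2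
  · rfl
  · rw [h _ (by omega)]
  · omega

namespace OnlineAlgorithm

variable {t : ℕ} (A : OnlineAlgorithm t)

/-- The bins of the items of the extra color in the phases of `1 / 7` and `1 / 3`. -/
def phaseBin (g : ℕ → Item) (N n : ℕ) (ε : ℚ) (e : ℕ → ℕ) : ℕ → ℕ :=
  A.extraBin g N (extraSize n ε e 1)

/-- The class consists of the high items that are the first of the extra color in their bin; larger
labels make them larger than the other high items. -/
theorem exists_extra_labels (g : ℕ → Item) (N n : ℕ) (ε : ℚ) :
    ∃ (e : ℕ → ℕ) (c : ℕ), c ≤ 4 ^ n ∧ (∀ i < n, e i < 4 ^ n) ∧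
      (∀ i < n, A.phaseBin g N n ε e (n + i) ∉ (Finset.range (n + i)).image
        (A.phaseBin g N n ε e) → c ≤ e i) ∧
      ∀ i < n, A.phaseBin g N n ε e (n + i) ∈ (Finset.range (n + i)).image
        (A.phaseBin g N n ε e) → e i < c := by
  obtain ⟨e, c, h1, h2, h3, h4⟩ := exists_labels_cut n
    -- The disjunct `n ≤ i` makes the causality condition trivial beyond the `n` labels in use.
    (fun e i => n ≤ i ∨ A.phaseBin g N n ε e (n + i) ∉ (Finset.range (n + i)).image
        (A.phaseBin g N n ε e)) (by
      intro e e' i h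
      rcases le_or_gt n i with hi | hi
      · simp [hi]
      have hb : ∀ j ≤ n + i, A.phaseBin g N n ε e j = A.phaseBin g N n ε e' j := fun j hj =>
        A.extraBin_congr fun l hl =>
          extraSize_congr (k := i + 1) (by omega) (fun k hk => h k (by omega)) (by omega)
      have hi' : (Finset.range (n + i)).image (A.phaseBin g N n ε e)
          = (Finset.range (n + i)).image (A.phaseBin g N n ε e') :=
        Finset.image_congr fun j hj => hb j (Finset.mem_range.1 hj).le
      rw [hb _ le_rfl, hi'])
  refine ⟨e, c, h1, h2, fun i hi hf => h3 i hi (Or.inr hf), fun i hi hf => h4 i hi ?_⟩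
  rintro (h | h)
  · omega
  · exact h hf

/-! ### Inequalities enforced by the extra color -/

/-- The state of the game after the phases of `1 / 7` and `1 / 3`. -/
structure IsExtraPhase (R : ℝ) (Q₀ N n : ℕ) (g : ℕ → Item) (ε : ℚ) (e : ℕ → ℕ) (c : ℕ) :
    Prop where
  R_nonneg : 0 ≤ R
  one_le : 1 ≤ t
  cost_le : ∀ I : List Item, Q₀ ≤ opt t I → (A.cost I : ℝ) ≤ R * opt t I
  le_N : t * Q₀ ≤ N
  color : ∀ i, (g i).color = i
  sum_le : ∑ i ∈ Finset.range N, (g i).size ≤ ε / 2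
  eps_pos : 0 < ε
  label_le : ∀ i < n, ε * (e i + 1) ≤ 1 / 1000
  cut_le : ε * (c + 1) ≤ 1 / 1000
  le_label : ∀ i < n, A.phaseBin g N n ε e (n + i) ∉ (Finset.range (n + i)).image
    (A.phaseBin g N n ε e) → c ≤ e i
  label_lt : ∀ i < n, A.phaseBin g N n ε e (n + i) ∈ (Finset.range (n + i)).image
    (A.phaseBin g N n ε e) → e i < c

namespace IsExtraPhase

variable {A} {R : ℝ} {Q₀ N n : ℕ} {g : ℕ → Item} {ε : ℚ} {e : ℕ → ℕ} {c : ℕ}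

theorem eps_le (h : A.IsExtraPhase R Q₀ N n g ε e c) : ε ≤ 1 / 1000 := by
  have h1 := h.cut_le
  have h2 := h.eps_pos
  have h3 : 0 ≤ ε * c := by positivity
  linarith

theorem le_extraSize_high (h : A.IsExtraPhase R Q₀ N n g ε e c) {τ : ℚ} {j : ℕ} (hj : j < n) :
    1 / 3 + ε ≤ extraSize n ε e τ (n + j) := by
  rw [extraSize_high hj]
  have h2 := h.eps_pos
  have h3 : 0 ≤ ε * e j := by positivity
  linarith

theorem extraSize_high_le (h : A.IsExtraPhase R Q₀ N n g ε e c) {τ : ℚ} {j : ℕ} (hj : j < n) :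
    extraSize n ε e τ (n + j) ≤ 1 / 3 + 1 / 1000 := by
  rw [extraSize_high hj]
  have := h.label_le j hj
  linarith

theorem extraSize_bounds (h : A.IsExtraPhase R Q₀ N n g ε e c) {τ : ℚ} (hτ : 1 / 7 < τ)
    (hτ1 : τ ≤ 1) (j : ℕ) : 1 / 7 < extraSize n ε e τ j ∧ extraSize n ε e τ j ≤ 1 := by
  rcases lt_or_ge j n with hj | hj
  · rw [extraSize_low hj]
    norm_num
  · obtain ⟨i, rfl⟩ := Nat.exists_eq_add_of_le hj
    rcases lt_or_ge i n with hi | hi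
    · have h1 := h.le_extraSize_high (τ := τ) hi
      have h2 := h.extraSize_high_le (τ := τ) hi
      have := h.eps_pos
      constructor <;> linarith
    · obtain ⟨k, rfl⟩ := Nat.exists_eq_add_of_le hi
      rw [← add_assoc, extraSize_tail]
      exact ⟨hτ, hτ1⟩

theorem extraBin_eq {τ : ℚ} {j : ℕ} (hj : j < n + n) :
    A.extraBin g N (extraSize n ε e τ) j = A.phaseBin g N n ε e j :=
  A.extraBin_congr fun _ hi => extraSize_congr le_rfl (fun _ _ => rfl) (hi.trans_lt hj)

theorem extraBins_eq {τ : ℚ} {m : ℕ} (hm : m ≤ n + n) :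
    A.extraBins g N (extraSize n ε e τ) m = (Finset.range m).image (A.phaseBin g N n ε e) :=
  Finset.image_congr fun _ hj => extraBin_eq ((Finset.mem_range.1 hj).trans_le hm)

theorem lowCount_eq {τ : ℚ} (b : ℕ) : lowCount (A.extraBin g N (extraSize n ε e τ)) n b
    = lowCount (A.phaseBin g N n ε e) n b := by
  unfold lowCount
  congr 1
  refine Finset.filter_congr fun j hj => ?_
  have := Finset.mem_range.1 hj
  rw [extraBin_eq (by omega)]

theorem highCount_eq {τ : ℚ} (b : ℕ) : highCount (A.extraBin g N (extraSize n ε e τ)) n b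
    = highCount (A.phaseBin g N n ε e) n b := by
  unfold highCount
  congr 1
  refine Finset.filter_congr fun j hj => ?_
  have := Finset.mem_range.1 hj
  rw [extraBin_eq (by omega)]

theorem capacity (h : A.IsExtraPhase R Q₀ N n g ε e c) {τ : ℚ} (hτ : 1 / 7 < τ) (hτ1 : τ ≤ 1)
    (m b : ℕ) :
    (lowCount (A.phaseBin g N n ε e) n b : ℚ) * (1007 / 7000)
      + highCount (A.phaseBin g N n ε e) n b * (1 / 3 + ε)
      + ∑ j ∈ Finset.range m with A.extraBin g N (extraSize n ε e τ) (n + n + j) = b, τ ≤ 1 := by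
  have h1 := A.capacity (g := g) (N := N) (n := n) (m := m) (ρ := extraSize n ε e τ)
    (x := 1007 / 7000) (y := 1 / 3 + ε) (fun j _ => by
      have := h.extraSize_bounds hτ hτ1 j
      exact ⟨by linarith, this.2⟩) (fun j hj => (extraSize_low hj).ge)
    (fun j hj => h.le_extraSize_high hj) b
  simpa only [extraSize_tail, lowCount_eq, highCount_eq] using h1

theorem capacity_of_tail (h : A.IsExtraPhase R Q₀ N n g ε e c) {τ : ℚ} (hτ : 1 / 7 < τ)
    (hτ1 : τ ≤ 1) {j b : ℕ} (hj : A.extraBin g N (extraSize n ε e τ) (n + n + j) = b) :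
    (lowCount (A.phaseBin g N n ε e) n b : ℚ) * (1007 / 7000)
      + highCount (A.phaseBin g N n ε e) n b * (1 / 3 + ε) + τ ≤ 1 := by
  refine le_trans ?_ (h.capacity hτ hτ1 (j + 1) b)
  have := Finset.single_le_sum (s := (Finset.range (j + 1)).filter
    fun j => A.extraBin g N (extraSize n ε e τ) (n + n + j) = b) (f := fun _ => τ)
    (fun _ _ => by linarith) (a := j) (Finset.mem_filter.2 ⟨by simp, hj⟩)
  linarith

/-- By volume, as `1007 / 7000 = 1 / 7 + 1 / 1000`: a bin cannot hold three high items, seven low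
ones, five low and one high, or three low and two high. -/
theorem counts (h : A.IsExtraPhase R Q₀ N n g ε e c) (b : ℕ) :
    highCount (A.phaseBin g N n ε e) n b ≤ 2 ∧
      (highCount (A.phaseBin g N n ε e) n b = 0 → lowCount (A.phaseBin g N n ε e) n b ≤ 6) ∧
      (highCount (A.phaseBin g N n ε e) n b = 1 → lowCount (A.phaseBin g N n ε e) n b ≤ 4) ∧
      (highCount (A.phaseBin g N n ε e) n b = 2 → lowCount (A.phaseBin g N n ε e) n b ≤ 2) := by
  have h1 := h.capacity (τ := 1) (by norm_num) le_rfl 0 b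
  simp only [Finset.range_zero, Finset.filter_empty, Finset.sum_empty, add_zero] at h1
  have hε := h.eps_pos
  generalize highCount (A.phaseBin g N n ε e) n b = j at *
  generalize lowCount (A.phaseBin g N n ε e) n b = k at *
  have hk0 : (0 : ℚ) ≤ k := Nat.cast_nonneg k
  have hj0 : (0 : ℚ) ≤ j * ε := by positivity
  refine ⟨?_, ?_, ?_, ?_⟩
  · by_contra hn
    have : (3 : ℚ) ≤ j := by exact_mod_cast (by omega : 3 ≤ j)
    have : 3 * ε ≤ j * ε := mul_le_mul_of_nonneg_right this hε.le
    linarith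
  all_goals
    rintro rfl
    by_contra hn
  · have : (7 : ℚ) ≤ k := by exact_mod_cast (by omega : 7 ≤ k)
    norm_num at h1
    linarith
  · have : (5 : ℚ) ≤ k := by exact_mod_cast (by omega : 5 ≤ k)
    norm_num at h1
    linarith
  · have : (3 : ℚ) ≤ k := by exact_mod_cast (by omega : 3 ≤ k)
    norm_num at h1
    linarith

/-- The number of fine-tuned items that do not open a bin. -/
theorem card_later : ((Finset.range n).filter fun i => A.phaseBin g N n ε e (n + i) ∈
      (Finset.range (n + i)).image (A.phaseBin g N n ε e)).card
      + ((Finset.range (n + n)).image (A.phaseBin g N n ε e)).card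
    = n + ((Finset.range n).image (A.phaseBin g N n ε e)).card := by
  set β := A.phaseBin g N n ε e
  have h1 := card_filter_first β (n + n)
  have h2 := card_filter_first β n
  have h3 := Finset.card_filter_add_card_filter_not (s := Finset.range n)
    (fun i => β (n + i) ∈ (Finset.range (n + i)).image β)
  rw [Finset.card_range] at h3
  rw [Finset.card_filter, Finset.sum_range_add, ← Finset.card_filter, ← Finset.card_filter] at h1
  omega

/-- Offline, six low items share a bin. -/
theorem ineq_low (h : A.IsExtraPhase R Q₀ N n g ε e c) {u K : ℕ} (hn : n = 6 * u)
    (hK : K ≤ (A.nonfullItems g N).card) (hKv : t * K + (t - 1) * u ≤ N) :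
    ((A.fullBins g N).card : ℝ) + ((Finset.range n).image (A.phaseBin g N n ε e)).card + K
      ≤ R * ((N + u : ℝ) / t + 1) := by
  have hε := h.eps_pos
  have hε1 := h.eps_le
  have h1 := A.ineq_of_extra h.R_nonneg h.one_le h.cost_le h.le_N h.color (η := ε / 2)
    (by linarith) (by linarith) h.sum_le (ρ := extraSize n ε e 1) (m := n) (v := u)
    (π := fun j => j / 6) (fun j _ => by
      have := h.extraSize_bounds (τ := 1) (by norm_num) le_rfl j
      exact ⟨by linarith, this.2⟩) (fun j hj => by omega) (fun b _ => by
      have := sum_filter_le_mul (n := n) (c := 6) (b := b) (u := b) (x := 1007 / 7000)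
        (w := extraSize n ε e 1) (π := fun j => j / 6) (q := id) (by norm_num) (by norm_num)
        (fun j hj _ => (extraSize_low hj).le) (fun i _ j _ hij => hij) (fun j _ hj => hj)
      norm_num at this
      linarith) hK hKv
  rwa [extraBins_eq (by omega)] at h1

/-- Offline, two low and two high items share a bin. -/
theorem ineq_high (h : A.IsExtraPhase R Q₀ N n g ε e c) {u K : ℕ} (hn : n = 2 * u)
    (hK : K ≤ (A.nonfullItems g N).card) (hKv : t * K + (t - 1) * u ≤ N) :
    ((A.fullBins g N).card : ℝ)
      + ((Finset.range (n + n)).image (A.phaseBin g N n ε e)).card + K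
      ≤ R * ((N + u : ℝ) / t + 1) := by
  have hε := h.eps_pos
  have hε1 := h.eps_le
  let π : ℕ → ℕ := fun j => if j < n then j / 2 else (j - n) / 2
  have hπ1 : ∀ j < n, π j = j / 2 := fun j hj => by simp [π, hj]
  have hπ2 : ∀ j, π (n + j) = j / 2 := fun j => by simp [π]
  have h1 := A.ineq_of_extra h.R_nonneg h.one_le h.cost_le h.le_N h.color (η := ε / 2)
    (by linarith) (by linarith) h.sum_le (ρ := extraSize n ε e 1) (m := n + n) (v := u)
    (π := π) (fun j _ => by
      have := h.extraSize_bounds (τ := 1) (by norm_num) le_rfl j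
      exact ⟨by linarith, this.2⟩) (fun j hj => by
        simp only [π]
        split_ifs <;> omega) (fun b _ => by
      rw [sum_range_add_filter]
      have h1 := sum_filter_le_mul (n := n) (c := 2) (b := b) (u := b) (x := 1007 / 7000)
        (w := extraSize n ε e 1) (π := π) (q := id) (by norm_num) (by norm_num)
        (fun j hj _ => (extraSize_low hj).le) (fun i _ j _ hij => hij)
        (fun j hj hjb => (hπ1 j hj).symm.trans hjb)
      have h2 := sum_filter_le_mul (n := n) (c := 2) (b := b) (u := b) (x := 1 / 3 + 1 / 1000)
        (w := fun j => extraSize n ε e 1 (n + j)) (π := fun j => π (n + j)) (q := id)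
        (by norm_num) (by norm_num)
        (fun j hj _ => h.extraSize_high_le hj) (fun i _ j _ hij => hij)
        (fun j _ hjb => (hπ2 j).symm.trans hjb)
      norm_num at h1 h2
      linarith) hK hKv
  rwa [extraBins_eq le_rfl] at h1

/-- Offline, each of `n` bins takes one low, one high and one third-phase item. No huge items
follow: for `N = (t - 1) * n` these bins already use up all tiny colors. -/
theorem ineq_ableA (h : A.IsExtraPhase R Q₀ N n g ε e c) (hN : (t - 1) * n ≤ N) :
    ((A.fullBins g N).card : ℝ)
      + ((Finset.range (n + n)).image (A.phaseBin g N n ε e)).card + n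
      ≤ R * ((N + n : ℝ) / t + 1) + (ableA (A.phaseBin g N n ε e) n).card := by
  have hε := h.eps_pos
  have hε1 := h.eps_le
  -- Of the slack `2 / 1000`, one half pays for the tuning of a high item and the other for the tiny
  -- items.
  obtain ⟨τ, hτ⟩ : ∃ τ : ℚ, τ = 1 - 1007 / 7000 - 1 / 3 - 2 / 1000 := ⟨_, rfl⟩
  have hτ7 : 1 / 7 < τ := by norm_num [hτ]
  have hτ1 : τ ≤ 1 := by norm_num [hτ]
  have hτ2 : 1 / 2 < τ := by norm_num [hτ]
  let π : ℕ → ℕ := fun j => if j < n then j else if j < n + n then j - n else j - (n + n)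
  have hπ1 : ∀ j < n, π j = j := fun j hj => by simp [π, hj]
  have hπ2 : ∀ j < n, π (n + j) = j := fun j hj => by simp [π, hj]
  have hπ3 : ∀ j, π (n + n + j) = j := fun j => by
    have h1 : ¬ n + n + j < n := by omega
    have h2 : ¬ n + n + j < n + n := by omega
    simp [π, h1, h2]
  have h1 := A.ineq_of_extra h.R_nonneg h.one_le h.cost_le h.le_N h.color (η := ε / 2) (K := 0)
    (by linarith) (by linarith) h.sum_le (ρ := extraSize n ε e τ) (m := n + n + n) (v := n)
    (π := π) (fun j _ => by
      have := h.extraSize_bounds hτ7 hτ1 j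
      exact ⟨by linarith, this.2⟩) (fun j hj => by
        simp only [π]
        split_ifs <;> omega) (fun b _ => by
      rw [sum_range_add_filter, sum_range_add_filter]
      have h1 := sum_filter_le_mul (n := n) (c := 1) (b := b) (u := b) (x := 1007 / 7000)
        (w := extraSize n ε e τ) (π := π) (q := id) (by norm_num) (by norm_num)
        (fun j hj _ => (extraSize_low hj).le) (fun i _ j _ hij => hij)
        (fun j hj hjb => by rw [Nat.div_one, id, ← hπ1 j hj, hjb])
      have h2 := sum_filter_le_mul (n := n) (c := 1) (b := b) (u := b) (x := 1 / 3 + 1 / 1000)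
        (w := fun j => extraSize n ε e τ (n + j)) (π := fun j => π (n + j)) (q := id)
        (by norm_num) (by norm_num)
        (fun j hj _ => h.extraSize_high_le hj) (fun i _ j _ hij => hij)
        (fun j hj hjb => by rw [Nat.div_one, id, ← hπ2 j hj, hjb])
      have h3 := sum_filter_le_mul (n := n) (c := 1) (b := b) (u := b) (x := τ)
        (w := fun j => extraSize n ε e τ (n + n + j)) (π := fun j => π (n + n + j)) (q := id)
        (by norm_num) (by linarith)
        (fun j _ _ => extraSize_tail.le) (fun i _ j _ hij => hij)
        (fun j _ hjb => by rw [Nat.div_one, id, ← hπ3 j, hjb])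
      rw [Nat.cast_one, one_mul] at h1 h2 h3
      linarith) (Nat.zero_le _) (by omega)
  have h2 := A.card_extraBins_add_le (g := g) (N := N) (m := n + n) (k := n)
    (ρ := extraSize n ε e τ) (S := ableA (A.phaseBin g N n ε e) n)
    (fun j _ => by rw [extraSize_tail]; exact ⟨hτ2, hτ1⟩) (fun j _ hmem => by
      rw [extraBins_eq le_rfl] at hmem
      refine Finset.mem_filter.2 ⟨hmem, ?_⟩
      have hcap := h.capacity_of_tail hτ7 hτ1 (j := j) rfl
      generalize A.extraBin g N (extraSize n ε e τ) (n + n + j) = b at *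
      generalize highCount (A.phaseBin g N n ε e) n b = y at *
      generalize lowCount (A.phaseBin g N n ε e) n b = k at *
      have hk0 : (0 : ℚ) ≤ k := Nat.cast_nonneg k
      have hy0 : (0 : ℚ) ≤ y * ε := by positivity
      rw [hτ] at hcap
      have hy : y ≤ 1 := by
        by_contra hn
        have : (2 : ℚ) ≤ y := by exact_mod_cast (by omega : 2 ≤ y)
        linarith
      interval_cases y
      · refine Or.inl ⟨rfl, ?_⟩
        by_contra hn
        have : (4 : ℚ) ≤ k := by exact_mod_cast (by omega : 4 ≤ k)
        norm_num at hcap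
        linarith
      · refine Or.inr ⟨rfl, ?_⟩
        by_contra hn
        have : (2 : ℚ) ≤ k := by exact_mod_cast (by omega : 2 ≤ k)
        norm_num at hcap
        linarith)
  rw [extraBins_eq le_rfl] at h2
  have h3 : (((Finset.range (n + n)).image (A.phaseBin g N n ε e)).card : ℝ) + n
      ≤ (A.extraBins g N (extraSize n ε e τ) (n + n + n)).card
        + (ableA (A.phaseBin g N n ε e) n).card := by exact_mod_cast h2
  rw [Nat.cast_zero] at h1
  linarith

/-- Offline, the `6 * p` third-phase items are paired with high items that opened no bin, the other
high items go in pairs with two low items each, and the `6 * p` low items left go in sixes. This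
takes `6 * p + (6 * M - 3 * p) + p` bins. -/
theorem ineq_ableB (h : A.IsExtraPhase R Q₀ N n g ε e c) {M p K : ℕ} (hn : n = 12 * M)
    (hp : 6 * p ≤ ((Finset.range n).filter fun i => A.phaseBin g N n ε e (n + i) ∈
      (Finset.range (n + i)).image (A.phaseBin g N n ε e)).card)
    (hK : K ≤ (A.nonfullItems g N).card) (hKv : t * K + (t - 1) * (6 * M + 4 * p) ≤ N) :
    ((A.fullBins g N).card : ℝ)
      + ((Finset.range (n + n)).image (A.phaseBin g N n ε e)).card + 6 * p + K
      ≤ R * ((N + (6 * M + 4 * p) : ℝ) / t + 1) + (ableB (A.phaseBin g N n ε e) n).card := by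
  have hε := h.eps_pos
  have hε1 := h.eps_le
  have hcut := h.cut_le
  have hc0 : 0 ≤ ε * c := by positivity
  -- A high item of label below `c` has size at most `1 / 3 + ε * c` and leaves exactly the room `ε
  -- / 2` needed for the tiny items; with a label of at least `c` the sum exceeds `1` by at least `ε
  -- / 2`.
  obtain ⟨τ, hτ⟩ : ∃ τ : ℚ, τ = 2 / 3 - ε * c - ε / 2 := ⟨_, rfl⟩
  have hτ2 : 1 / 2 < τ := by rw [hτ]; linarith
  have hτ7 : 1 / 7 < τ := by linarith
  have hτ1 : τ ≤ 1 := by rw [hτ]; linarith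
  set D := (Finset.range n).filter fun i => A.phaseBin g N n ε e (n + i) ∈
      (Finset.range (n + i)).image (A.phaseBin g N n ε e) with hD
  have hpn : 6 * p ≤ n := hp.trans ((Finset.card_filter_le _ _).trans_eq (Finset.card_range n))
  obtain ⟨r, s, hr, hs, hrD⟩ := exists_rank (N := n) D fun i hi =>
    Finset.mem_range.1 (Finset.mem_filter.1 hi).1
  have hrinj : ∀ i < n, ∀ j < n, r i = r j → i = j := fun i hi j hj hij => by
    rw [← (hr i hi).2, ← (hr j hj).2, hij]
  let πa : ℕ → ℕ := fun j =>
    if j < n - 6 * p then 6 * p + j / 2 else 3 * p + 6 * M + (j - (n - 6 * p)) / 6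
  let πb : ℕ → ℕ := fun j => if r j < 6 * p then r j else 6 * p + (r j - 6 * p) / 2
  let π : ℕ → ℕ := fun j =>
    if j < n then πa j else if j < n + n then πb (j - n) else j - (n + n)
  have hπ1 : ∀ j < n, π j = πa j := fun j hj => by simp [π, hj]
  have hπ2 : ∀ j < n, π (n + j) = πb j := fun j hj => by simp [π, hj]
  have hπ3 : ∀ j, π (n + n + j) = j := fun j => by
    have h1 : ¬ n + n + j < n := by omega
    have h2 : ¬ n + n + j < n + n := by omega
    simp [π, h1, h2]
  have hfit : ∀ b < 6 * M + 4 * p, ∑ j ∈ Finset.range (n + n + 6 * p) with π j = b,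
      extraSize n ε e τ j ≤ 1 - ε / 2 := by
    intro b hb
    rw [sum_range_add_filter, sum_range_add_filter]
    have ea : ∑ j ∈ Finset.range n with π j = b, extraSize n ε e τ j
        = ∑ j ∈ Finset.range n with πa j = b, extraSize n ε e τ j := by
      rw [Finset.filter_congr fun j hj => by rw [hπ1 j (Finset.mem_range.1 hj)]]
    have eb : ∑ j ∈ Finset.range n with π (n + j) = b, extraSize n ε e τ (n + j)
        = ∑ j ∈ Finset.range n with πb j = b, extraSize n ε e τ (n + j) := by
      rw [Finset.filter_congr fun j hj => by rw [hπ2 j (Finset.mem_range.1 hj)]]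
    rw [ea, eb]
    rcases lt_or_ge b (6 * p) with hb1 | hb1
    · have h1 : ∑ j ∈ Finset.range n with πa j = b, extraSize n ε e τ j = 0 :=
        sum_filter_eq_zero_of_ne fun j hj => by
          simp only [πa]
          split_ifs <;> omega
      have hπb : ∀ j, πb j = b → r j = b := fun j hjb => by
        simp only [πb] at hjb
        split_ifs at hjb <;> omega
      have h2 := sum_filter_le_mul (n := n) (c := 1) (b := b) (u := b) (x := 1 / 3 + ε * c)
        (w := fun j => extraSize n ε e τ (n + j)) (π := πb) (q := r)
        (by norm_num) (by linarith)
        (fun j hj hjb => by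
          have hjr := hπb j hjb
          have hjD : j ∈ D := (hrD j hj).2 (by omega)
          have hlt := h.label_lt j hj (Finset.mem_filter.1 hjD).2
          have hlt' : (e j : ℚ) + 1 ≤ c := by exact_mod_cast hlt
          simp only [extraSize_high hj]
          have := mul_le_mul_of_nonneg_left hlt' hε.le
          linarith) hrinj
        (fun j _ hjb => by rw [Nat.div_one, hπb j hjb])
      have h3 := sum_filter_le_mul (n := 6 * p) (c := 1) (b := b) (u := b) (x := τ)
        (w := fun j => extraSize n ε e τ (n + n + j)) (π := fun j => π (n + n + j)) (q := id)
        (by norm_num) (by linarith)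
        (fun j _ _ => extraSize_tail.le) (fun i _ j _ hij => hij)
        (fun j _ hjb => by rw [Nat.div_one, id, ← hπ3 j, hjb])
      rw [Nat.cast_one, one_mul] at h2 h3
      linarith
    · have h3 : ∑ j ∈ Finset.range (6 * p) with π (n + n + j) = b,
          extraSize n ε e τ (n + n + j) = 0 :=
        sum_filter_eq_zero_of_ne fun j hj => by
          rw [hπ3]
          omega
      rcases lt_or_ge b (3 * p + 6 * M) with hb2 | hb2
      · have h1 := sum_filter_le_mul (n := n) (c := 2) (b := b) (u := b - 6 * p)
          (x := 1007 / 7000) (w := extraSize n ε e τ) (π := πa) (q := id) (by norm_num)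
          (by norm_num) (fun j hj _ => (extraSize_low hj).le) (fun i _ j _ hij => hij)
          (fun j hj hjb => by
            simp only [πa] at hjb
            simp only [id]
            split_ifs at hjb <;> omega)
        -- If `6 * p + (r j - 6 * p) / 2 = b` with `6 * p ≤ r j`, then `r j / 2 = b - 3 * p`.
        have h2 := sum_filter_le_mul (n := n) (c := 2) (b := b) (u := b / 1 - 3 * p)
          (x := 1 / 3 + 1 / 1000)
          (w := fun j => extraSize n ε e τ (n + j)) (π := πb) (q := r)
          (by norm_num) (by norm_num)
          (fun j hj _ => h.extraSize_high_le hj) hrinj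
          (fun j _ hjb => by
            simp only [πb] at hjb
            split_ifs at hjb <;> omega)
        norm_num at h1 h2
        linarith
      -- The map `q` moves the left-over low items to `0, 1, …`, where the sixes are quotients by
      -- `6`, and keeps injectivity by moving the others to `n` and beyond.
      · have h1 := sum_filter_le_mul (n := n) (c := 6) (b := b) (u := b - (3 * p + 6 * M))
          (x := 1007 / 7000) (w := extraSize n ε e τ) (π := πa)
          (q := fun j => if j < n - 6 * p then n + j else j - (n - 6 * p)) (by norm_num)
          (by norm_num) (fun j hj _ => (extraSize_low hj).le)
          (fun i hi j hj hij => by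
            split_ifs at hij <;> omega)
          (fun j hj hjb => by
            simp only [πa] at hjb
            split_ifs at hjb ⊢ <;> omega)
        have h2 : ∑ j ∈ Finset.range n with πb j = b, extraSize n ε e τ (n + j) = 0 :=
          sum_filter_eq_zero_of_ne fun j hj => by
            have := (hr j hj).1
            simp only [πb]
            split_ifs <;> omega
        norm_num at h1
        linarith
  have h1 := A.ineq_of_extra h.R_nonneg h.one_le h.cost_le h.le_N h.color (η := ε / 2)
    (by linarith) (by linarith) h.sum_le (ρ := extraSize n ε e τ) (m := n + n + 6 * p)
    (v := 6 * M + 4 * p) (π := π) (fun j _ => by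
      have := h.extraSize_bounds hτ7 hτ1 j
      exact ⟨by linarith, this.2⟩) (fun j hj => by
        simp only [π]
        split_ifs with c1 c2
        · simp only [πa]
          split_ifs <;> omega
        · have := (hr (j - n) (by omega)).1
          simp only [πb]
          split_ifs <;> omega
        · omega) hfit hK hKv
  have h2 := A.card_extraBins_add_le (g := g) (N := N) (m := n + n) (k := 6 * p)
    (ρ := extraSize n ε e τ) (S := ableB (A.phaseBin g N n ε e) n)
    (fun j _ => by rw [extraSize_tail]; exact ⟨hτ2, hτ1⟩) (fun j _ hmem => by
      -- Without low items, a bin with a high item got a high item as its first of the extra color.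
      -- Its label is at least `c`, so a third-phase item does not fit.
      have hne : ∀ i < n, lowCount (A.phaseBin g N n ε e) n
          (A.extraBin g N (extraSize n ε e τ) (n + n + j)) = 0 →
          A.phaseBin g N n ε e (n + i) ≠ A.extraBin g N (extraSize n ε e τ) (n + n + j) := by
        intro i hi h0 hij
        obtain ⟨l, hl, hli, hfirst⟩ := exists_first (A.phaseBin g N n ε e) (n + i)
        have hln : n ≤ l := by
          by_contra hlt
          have : 0 < lowCount (A.phaseBin g N n ε e) n
              (A.extraBin g N (extraSize n ε e τ) (n + n + j)) := by
            rw [lowCount_pos_iff, ← hij, ← hli]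
            exact Finset.mem_image_of_mem _ (Finset.mem_range.2 (by omega))
          omega
        obtain ⟨l, rfl⟩ := Nat.exists_eq_add_of_le hln
        have hlab := h.le_label l (by omega) hfirst
        have hlab' : (c : ℚ) ≤ e l := by exact_mod_cast hlab
        have hsz := A.size_add_size_le (f := extend g N (extraSize n ε e τ)) (i := N + (n + l))
          (j := N + (n + n + j)) (by omega) (by
            have h2 := extraBin_eq (A := A) (g := g) (N := N) (ε := ε) (e := e) (τ := τ)
              (n := n) (j := n + l) (by omega)
            exact h2.trans (hli.trans hij))
        have b1 := h.extraSize_bounds hτ7 hτ1 (n + l)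
        have b2 := h.extraSize_bounds hτ7 hτ1 (n + n + j)
        simp only [extend, Nat.add_sub_cancel_left,
          if_neg (Nat.not_lt.2 (Nat.le_add_right N _))] at hsz
        rw [mkItem_size (by linarith) b1.2, mkItem_size (by linarith) b2.2, extraSize_tail,
          extraSize_high (by omega)] at hsz
        have := mul_le_mul_of_nonneg_left hlab' hε.le
        rw [hτ] at hsz
        linarith
      rw [extraBins_eq le_rfl] at hmem
      refine Finset.mem_filter.2 ⟨hmem, ?_⟩
      have hcap := h.capacity_of_tail hτ7 hτ1 (j := j) rfl
      have hy : lowCount (A.phaseBin g N n ε e) n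
          (A.extraBin g N (extraSize n ε e τ) (n + n + j)) = 0 →
          highCount (A.phaseBin g N n ε e) n
            (A.extraBin g N (extraSize n ε e τ) (n + n + j)) = 0 := by
        intro h0
        rw [highCount, Finset.card_eq_zero, Finset.filter_eq_empty_iff]
        exact fun i hi => hne i (Finset.mem_range.1 hi) h0
      generalize A.extraBin g N (extraSize n ε e τ) (n + n + j) = b at *
      generalize highCount (A.phaseBin g N n ε e) n b = y at *
      generalize lowCount (A.phaseBin g N n ε e) n b = k at *
      have hk0 : (0 : ℚ) ≤ k := Nat.cast_nonneg k
      have hy0 : (0 : ℚ) ≤ y * ε := by positivity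
      have hy1 : (0 : ℚ) ≤ y := Nat.cast_nonneg y
      rw [hτ] at hcap
      rcases Nat.eq_zero_or_pos k with rfl | hk
      · exact ⟨hy rfl, by omega⟩
      · have hk1 : (1 : ℚ) ≤ k := by exact_mod_cast hk
        have hy' : y = 0 := by
          by_contra hn
          have : (1 : ℚ) ≤ y := by exact_mod_cast (by omega : 1 ≤ y)
          linarith
        refine ⟨hy', ?_⟩
        by_contra hn
        have : (3 : ℚ) ≤ k := by exact_mod_cast (by omega : 3 ≤ k)
        linarith)
  rw [extraBins_eq le_rfl] at h2
  have h3 : (((Finset.range (n + n)).image (A.phaseBin g N n ε e)).card : ℝ) + 6 * p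
      ≤ (A.extraBins g N (extraSize n ε e τ) (n + n + 6 * p)).card
        + (ableB (A.phaseBin g N n ε e) n).card := by exact_mod_cast h2
  push_cast at h1
  linarith

end IsExtraPhase

end OnlineAlgorithm

/-! ### The linear system and the two bounds -/

/-- There are at least `min y (z - 1)` and at most `min y z` many. -/
theorem exists_nat_le_min {y a t : ℕ} (ht : 1 ≤ t) :
    ∃ K : ℕ, K ≤ y ∧ t * K ≤ a ∧ min (y : ℝ) ((a : ℝ) / t - 1) ≤ K := by
  have htR : (0 : ℝ) < t := by exact_mod_cast ht
  refine ⟨min y (a / t), min_le_left _ _, ?_, ?_⟩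
  · exact (Nat.mul_le_mul_left t (min_le_right _ _)).trans (Nat.mul_div_le a t)
  · rw [Nat.cast_min]
    refine min_le_min le_rfl ?_
    have h : a < t * (a / t + 1) := Nat.lt_mul_div_succ a ht
    have h' : (a : ℝ) < t * (((a / t : ℕ) : ℝ) + 1) := by exact_mod_cast h
    rw [sub_le_iff_le_add, div_le_iff₀ htR]
    linarith

theorem le_or_le_of_add_min_le {x y k B : ℝ} (h : x + min y k ≤ B) :
    y ≤ k ∧ x + y ≤ B ∨ k ≤ y ∧ x + k ≤ B := by
  rcases le_total y k with hk | hk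
  · exact Or.inl ⟨hk, by rwa [min_eq_left hk] at h⟩
  · exact Or.inr ⟨hk, by rwa [min_eq_right hk] at h⟩

namespace OnlineAlgorithm

variable {t : ℕ} (A : OnlineAlgorithm t)

/-- The inequalities that the adversary enforces against an `R`-competitive algorithm: `X` is the
number of bins after the tiny items, `F` the number of full ones, `y` the number of tiny items in
the other bins, `b` and `T` the numbers of bins with items of the extra color after its first two
phases, `u` and `w` the numbers of those bins that can receive an item of the third phase, and
`d` the number of fine-tuned items that do not open a bin. -/
theorem exists_game_values {R : ℝ} (hR : 0 ≤ R) {Q₀ M : ℕ} (ht : 2 ≤ t)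
    (H : ∀ I : List Item, Q₀ ≤ opt t I → (A.cost I : ℝ) ≤ R * opt t I)
    (hM : t * Q₀ ≤ M) (htM : t ≤ M) :
    ∃ X F y b T u w d p : ℕ, ∃ N : ℝ, N = (t - 1) * (12 * M) ∧
      (X : ℝ) + ((N - X) / t - 1) ≤ R * (N / t + 1) ∧
      N ≤ (t - 1) * X + F ∧ t * F + y = N ∧ d + T = 12 * M + b ∧
      3 * (12 * M) + 2 * u + 2 * w ≤ 2 * b + 4 * T ∧
      F + b + min (y : ℝ) ((N - (t - 1) * (2 * M)) / t - 1) ≤ R * ((N + 2 * M) / t + 1) ∧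
      F + T + min (y : ℝ) ((N - (t - 1) * (6 * M)) / t - 1) ≤ R * ((N + 6 * M) / t + 1) ∧
      F + T + 12 * M ≤ R * ((N + 12 * M) / t + 1) + u ∧
      6 * p ≤ 9 * M ∧ 6 * p ≤ d ∧ min d (9 * M) ≤ 6 * p + 5 ∧
      F + T + 6 * p + min (y : ℝ) ((N - (t - 1) * (6 * M + 4 * p)) / t - 1)
        ≤ R * ((N + (6 * M + 4 * p)) / t + 1) + w := by
  have ht1 : 1 ≤ t := by omega
  set n := 12 * M with hn
  -- The largest offline packing has `n` bins with the extra color, each with room for `t - 1` tiny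
  -- colors.
  obtain ⟨N, hNdef⟩ : ∃ N, N = (t - 1) * n := ⟨_, rfl⟩
  have hMN : M ≤ N := by
    have : 1 * n ≤ (t - 1) * n := Nat.mul_le_mul_right n (by omega)
    rw [← hNdef] at this
    omega
  -- Labels and cut are at most `4 ^ n`, so the tuning stays within `1 / 1000`.
  set ε : ℚ := 1 / (1000 * (4 ^ n + 2)) with hε
  have hε0 : 0 < ε := by positivity
  have hε2 : ε * (4 ^ n + 2) = 1 / 1000 := by
    rw [hε]
    field_simp
  have hε1 : ε ≤ 1 / 1000 := by
    rw [← hε2]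
    have : (0 : ℚ) ≤ 4 ^ n := by positivity
    exact le_mul_of_one_le_right hε0.le (by linarith)
  have hlab : ∀ k : ℕ, k ≤ 4 ^ n → ε * (k + 1) ≤ 1 / 1000 := fun k hk => by
    rw [← hε2]
    have : (k : ℚ) ≤ 4 ^ n := by exact_mod_cast hk
    exact mul_le_mul_of_nonneg_left (by linarith) hε0.le
  obtain ⟨g, δ, hcol, hsum, hδ0, hδ1, hlarge, hsmall⟩ :=
    A.exists_tiny_phase (N := N) (η := ε / 2) (by omega) (by omega) (by linarith) (by linarith)
  obtain ⟨e, c, hc, he, hle, hlt⟩ := A.exists_extra_labels g N n ε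
  have hN : t * Q₀ ≤ N := hM.trans hMN
  have h : A.IsExtraPhase R Q₀ N n g ε e c :=
    ⟨hR, ht1, H, hN, hcol, hsum, hε0, fun i hi => hlab _ (he i hi).le, hlab c hc, hle, hlt⟩
  have htsub : ((t - 1 : ℕ) : ℝ) = t - 1 := by
    rw [Nat.cast_sub ht1, Nat.cast_one]
  have hNR : (N : ℝ) = (t - 1) * (12 * M) := by
    rw [hNdef, hn, Nat.cast_mul, htsub]
    push_cast
    rfl
  have huge : ∀ v : ℕ, v ≤ n → ∃ K : ℕ, K ≤ (A.nonfullItems g N).card ∧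
      t * K + (t - 1) * v ≤ N ∧
      min ((A.nonfullItems g N).card : ℝ) ((N - (t - 1) * v) / t - 1) ≤ K := by
    intro v hv
    have hvN : (t - 1) * v ≤ N := hNdef ▸ Nat.mul_le_mul_left _ hv
    obtain ⟨K, h1, h2, h3⟩ := exists_nat_le_min (y := (A.nonfullItems g N).card)
      (a := N - (t - 1) * v) ht1
    refine ⟨K, h1, by omega, ?_⟩
    rw [Nat.cast_sub hvN, Nat.cast_mul, htsub] at h3
    exact h3
  set D := (Finset.range n).filter fun i => A.phaseBin g N n ε e (n + i) ∈
      (Finset.range (n + i)).image (A.phaseBin g N n ε e) with hD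
  -- The `6 * M + 4 * p` offline bins must not exceed `n = 12 * M`, whence the cap `9 * M` on `6 *
  -- p`. Rounding loses at most `5`.
  set p := min D.card (9 * M) / 6 with hp
  have hp6 : 6 * p ≤ min D.card (9 * M) := Nat.mul_div_le _ _
  obtain ⟨K1, k11, k12, k13⟩ := huge (2 * M) (by omega)
  obtain ⟨K2, k21, k22, k23⟩ := huge (6 * M) (by omega)
  obtain ⟨K3, k31, k32, k33⟩ := huge (6 * M + 4 * p) (by omega)
  have i1 := h.ineq_low (u := 2 * M) (by omega) k11 k12
  have i2 := h.ineq_high (u := 6 * M) (by omega) k21 k22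
  have i3 := h.ineq_ableA hNdef.ge
  have i4 := h.ineq_ableB (M := M) (p := p) hn (hp6.trans (min_le_left _ _)) k31 k32
  have hw := weight_ineq h.counts
  have hd := IsExtraPhase.card_later (A := A) (g := g) (N := N) (n := n) (ε := ε) (e := e)
  push_cast at k13 k23 k33 i1 i2
  refine ⟨((Finset.range N).image (A.binOf g)).card, (A.fullBins g N).card,
    (A.nonfullItems g N).card, ((Finset.range n).image (A.phaseBin g N n ε e)).card,
    ((Finset.range (n + n)).image (A.phaseBin g N n ε e)).card,
    (ableA (A.phaseBin g N n ε e) n).card, (ableB (A.phaseBin g N n ε e) n).card,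
    D.card, p, N, hNR, ?_, ?_, ?_, hd, hw, by linarith, by linarith, ?_, by omega, by omega,
    by omega, by linarith⟩
  · exact A.ineq_of_tiny_phase hR ht1 H hN hcol (by linarith) hδ0 (by linarith) hlarge hsmall
  · have := A.le_mul_card_bins_add ht1 (N := N) fun i _ => hcol i
    rw [← htsub]
    exact_mod_cast this
  · exact_mod_cast A.mul_card_fullBins_add g N
  · rw [hn] at i3 ⊢
    push_cast at i3
    exact i3

theorem le_competitiveRatio_two (A : OnlineAlgorithm 2) :
    ENNReal.ofReal 1.717668486 ≤ A.competitiveRatio := by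
  by_contra! hlt
  obtain ⟨Q₀, H⟩ := A.exists_cost_le (by norm_num) hlt
  -- The term `2 * Q₀` provides the required size of the optimum, and `1000000` outweighs the
  -- additive rounding constants.
  obtain ⟨X, F, y, b, T, u, w, d, p, N, hN, h0, h1, h2, h3, h4, h5, h6, h7, h8, h9, h10, h11⟩ :=
    A.exists_game_values (M := 2 * Q₀ + 1000000) (by norm_num) (by norm_num) H (by omega)
      (by omega)
  have hM : (1000000 : ℝ) ≤ (2 * Q₀ + 1000000 : ℕ) := by
    push_cast
    linarith [Q₀.cast_nonneg (α := ℝ)]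
  generalize 2 * Q₀ + 1000000 = M at *
  have hb : (0 : ℝ) ≤ b := b.cast_nonneg
  have hu : (0 : ℝ) ≤ u := u.cast_nonneg
  have hw : (0 : ℝ) ≤ w := w.cast_nonneg
  have hy : (0 : ℝ) ≤ y := y.cast_nonneg
  have hp : (0 : ℝ) ≤ p := p.cast_nonneg
  rify at h3 h4 h8 h9 h10
  subst hN
  norm_num only [Nat.cast_ofNat] at h0 h1 h2 h5 h6 h7 h11
  -- Once each of the four minima is resolved, the 16 cases are infeasible linear systems.
  rcases min_le_iff.1 h10 with h10 | h10 <;>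
  rcases le_or_le_of_add_min_le h5 with ⟨k1, h5⟩ | ⟨k1, h5⟩ <;>
  rcases le_or_le_of_add_min_le h6 with ⟨k2, h6⟩ | ⟨k2, h6⟩ <;>
  rcases le_or_le_of_add_min_le h11 with ⟨k3, h11⟩ | ⟨k3, h11⟩ <;>
  linarith

theorem le_competitiveRatio_three (A : OnlineAlgorithm 3) :
    ENNReal.ofReal 1.80814287 ≤ A.competitiveRatio := by
  by_contra! hlt
  obtain ⟨Q₀, H⟩ := A.exists_cost_le (by norm_num) hlt
  obtain ⟨X, F, y, b, T, u, w, d, p, N, hN, h0, h1, h2, h3, h4, h5, h6, h7, h8, h9, h10, h11⟩ :=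
    A.exists_game_values (M := 3 * Q₀ + 1000000) (by norm_num) (by norm_num) H (by omega)
      (by omega)
  have hM : (1000000 : ℝ) ≤ (3 * Q₀ + 1000000 : ℕ) := by
    push_cast
    linarith [Q₀.cast_nonneg (α := ℝ)]
  generalize 3 * Q₀ + 1000000 = M at *
  have hb : (0 : ℝ) ≤ b := b.cast_nonneg
  have hu : (0 : ℝ) ≤ u := u.cast_nonneg
  have hw : (0 : ℝ) ≤ w := w.cast_nonneg
  have hy : (0 : ℝ) ≤ y := y.cast_nonneg
  have hp : (0 : ℝ) ≤ p := p.cast_nonneg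
  rify at h3 h4 h8 h9 h10
  subst hN
  norm_num only [Nat.cast_ofNat] at h0 h1 h2 h5 h6 h7 h11
  rcases min_le_iff.1 h10 with h10 | h10 <;>
  rcases le_or_le_of_add_min_le h5 with ⟨k1, h5⟩ | ⟨k1, h5⟩ <;>
  rcases le_or_le_of_add_min_le h6 with ⟨k2, h6⟩ | ⟨k2, h6⟩ <;>
  rcases le_or_le_of_add_min_le h11 with ⟨k3, h11⟩ | ⟨k3, h11⟩ <;>
  linarith

end OnlineAlgorithm

theorem theorem4 :
    (∀ A : OnlineAlgorithm 2, ENNReal.ofReal 1.717668486 ≤ A.competitiveRatio) ∧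
    (∀ A : OnlineAlgorithm 3, ENNReal.ofReal 1.80814287 ≤ A.competitiveRatio) := by
  exact ⟨OnlineAlgorithm.le_competitiveRatio_two, OnlineAlgorithm.le_competitiveRatio_three⟩
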